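/- Let $n\ge 1$, $A\in\mathbb C^{n\times n}$ and $\theta\in\mathbb R$, with $\langle x,y\rangle=x^*y$ and the Euclidean norm on $\mathbb C^n$. Let $\Lambda(A)$ be the set of eigenvalues of $A$. Define the scaled relative graph $$\mathrm{SRG}(A)=\Big\{\tfrac{\|y\|}{\|x\|}\exp\Big(\pm i\arccos\tfrac{\mathrm{Re}\langle x,y\rangle}{\|x\|\|y\|}\Big): y=Ax,\ x\ne 0\Big\},$$ where a pair with $y=0$ contributes the point $0$; the $\theta$-SRG $\mathrm{SRG}_\theta(A)=e^{i\theta}\,\mathrm{SRG}(e^{-i\theta}A)$; the $\theta$-axis $e^{i\theta}\mathbb R$; the closed half planes $\mathbb C_{\theta+}=e^{i\theta}\{\mathrm{Im}\,z\ge0\}$ and $\mathbb C_{\theta-}=e^{i\theta}\{\mathrm{Im}\,z\le0\}$; and $\mathrm{SRG}_{\theta+}(A)=\mathrm{SRG}_\theta(A)\cap\mathbb C_{\theta+}$. Let $\mathrm{DW}(A)=\{(\langle x,y\rangle/\|x\|^2,\ \|y\|^2/\|x\|^2): y=Ax,\ x\neq0\}\subseteq\mathbb C\times\mathbb R$ be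 the Davis-Wielandt shell. For $|z|^2\le r$ put $\mathrm{pr}_\theta(z,r)=\big(e^{i\theta}(t+i\sqrt{r-t^2}),\,r\big)$ with $t=\mathrm{Re}(e^{-i\theta}z)$. For distinct $z_1,z_2\in\mathbb C_{\theta+}$, the minor arc centered on the $\theta$-axis joining them is the portion between $z_1$ and $z_2$ of the semicircle in $\mathbb C_{\theta+}$ that passes through both and has its center on the $\theta$-axis; if $z_1,z_2$ have the same orthogonal projection on the $\theta$-axis, it is the straight segment from $z_1$ to $z_2$ (center at infinity). Then: 1. $\mathrm{SRG}_\theta(A)=\mathrm{SRG}_{\theta+\pi}(A)$. 2. $\mathrm{SRG}_\theta(A)=\mathrm{SRG}_\theta(A^{T})=\overline{\mathrm{SRG}_{-\theta}(A^{*})}$ (pointwise complex conjugation); $\mathrm{SRG}_\theta(e^{i\alpha}A)=e^{i\alpha}\,\mathrm{SRG}_{\theta-\alpha}(A)$ for all $\alpha\in\mathbb R$; $\mathrm{SRG}_\theta(\gamma A)=\gamma\,\mathrm{SRG}_\theta(A)$ for all $\gamma\ge0$; $\mathrm{SRG}_\theta(U^*AU)=\mathrm{SRG}_\theta(A)$ for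 all unitary $U$. 3. The intersection of $\mathrm{SRG}_{\theta+}(A)$ with the $\theta$-axis is exactly the set of eigenvalues of $A$ lying on the $\theta$-axis. The set of points of $\mathrm{DW}(A)$ fixed by $\mathrm{pr}_\theta$ is $\{(\lambda,|\lambda|^2):\lambda\in\Lambda(A)\cap\mathbb C_{\theta+}\}$, and the set of points of $\mathrm{DW}(A)$ fixed by $\mathrm{pr}_{\theta+\pi}$ is $\{(\lambda,|\lambda|^2):\lambda\in\Lambda(A)\cap\mathbb C_{\theta-}\}$. Moreover $\Lambda(A)\subseteq\mathrm{SRG}_\theta(A)$, and $$\Lambda(A)=\bigcap_{\varphi\in[-\pi/2,\pi/2)}\mathrm{SRG}_\varphi(A).$$ 4. $\mathrm{SRG}_{\theta+}(A)$ is simply connected, and for any two distinct points $z_1,z_2\in\mathrm{SRG}_{\theta+}(A)$, the minor arc centered on the $\theta$-axis joining $z_1$ and $z_2$ is contained in $\mathrm{SRG}_{\theta+}(A)$. 5. Suppose that $A$ is normal, and let $E$ be the set obtained from $\Lambda(A)$ by keeping the eigenvalues in $\mathbb C_{\theta+}$ and replacing every other eigenvalue by its mirror image across the $\theta$-axis.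 If $E$ has at least two points, the boundary of $\mathrm{SRG}_{\theta+}(A)$ in $\mathbb C$ is a union of minor arcs centered on the $\theta$-axis, each joining two distinct points of $E$. If $E$ is a single point, the boundary of $\mathrm{SRG}_{\theta+}(A)$ is $E$. -/

import Mathlib

open scoped Matrix Pointwise ComplexConjugate

namespace ThetaSRG

noncomputable section

/-- The set `Λ(A)` of eigenvalues of `A`. -/
def eigs {n : ℕ} (A : Matrix (Fin n) (Fin n) ℂ) : Set ℂ :=
  {l | Module.End.HasEigenvalue (Matrix.toLin' A) l}

/-- The graph of `A`: all pairs `(x, y)` with `y = A x`. -/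
def graph {n : ℕ} (A : Matrix (Fin n) (Fin n) ℂ) :
    Set (EuclideanSpace ℂ (Fin n) × EuclideanSpace ℂ (Fin n)) :=
  {p | p.2 = Matrix.toEuclideanLin A p.1}

/-- The Davis-Wielandt shell of `A`, a subset of `ℂ × ℝ`
(Mathlib's inner product is conjugate-linear in the first variable). -/
def dwShell {n : ℕ} (A : Matrix (Fin n) (Fin n) ℂ) : Set (ℂ × ℝ) :=
  {p | ∃ x y : EuclideanSpace ℂ (Fin n), (x, y) ∈ graph A ∧ x ≠ 0 ∧
    p = (inner ℂ x y / ((‖x‖ ^ 2 : ℝ) : ℂ), ‖y‖ ^ 2 / ‖x‖ ^ 2)}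

/-- The scaled relative graph of `A`. A pair with `x ≠ 0` and `y = A x = 0` contributes the
point `0`, since the gain `‖y‖ / ‖x‖` is then zero. -/
def srg {n : ℕ} (A : Matrix (Fin n) (Fin n) ℂ) : Set ℂ :=
  {z | ∃ x y : EuclideanSpace ℂ (Fin n), (x, y) ∈ graph A ∧ x ≠ 0 ∧
    ∃ s : ℝ, (s = 1 ∨ s = -1) ∧
      z = ((‖y‖ / ‖x‖ : ℝ) : ℂ) *
        Complex.exp (Complex.I *
          ((s * Real.arccos ((inner ℂ x y).re / (‖x‖ * ‖y‖)) : ℝ) : ℂ))}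

/-- The unimodular number `e^{iθ}`. -/
def cis (θ : ℝ) : ℂ := Complex.exp (Complex.I * (θ : ℂ))

/-- The `θ`-SRG of `A`: `e^{iθ} SRG(e^{-iθ} A)`. -/
def thetaSRG {n : ℕ} (θ : ℝ) (A : Matrix (Fin n) (Fin n) ℂ) : Set ℂ :=
  cis θ • srg (cis (-θ) • A)

/-- The `θ`-axis `e^{iθ} ℝ`. -/
def thetaAxis (θ : ℝ) : Set ℂ := cis θ • {z : ℂ | z.im = 0}

/-- The closed half plane `e^{iθ} {Im z ≥ 0}`. -/
def upperHalf (θ : ℝ) : Set ℂ := cis θ • {z : ℂ | 0 ≤ z.im}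

/-- The closed half plane `e^{iθ} {Im z ≤ 0}`. -/
def lowerHalf (θ : ℝ) : Set ℂ := cis θ • {z : ℂ | z.im ≤ 0}

/-- The portion of the `θ`-SRG in the closed half plane `e^{iθ} {Im z ≥ 0}`. -/
def thetaSRGUpper {n : ℕ} (θ : ℝ) (A : Matrix (Fin n) (Fin n) ℂ) : Set ℂ :=
  thetaSRG θ A ∩ upperHalf θ

/-- The map `(z, r) ↦ (Re z + i √(r - (Re z)²), r)`, of interest on `{(z, r) | |z|² ≤ r}`. -/
def projParab (p : ℂ × ℝ) : ℂ × ℝ :=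
  ((p.1.re : ℂ) + Complex.I * ((Real.sqrt (p.2 - p.1.re ^ 2) : ℝ) : ℂ), p.2)

/-- The `θ`-projection: `projParab` conjugated by the rotation by `θ` of the first coordinate. -/
def thetaProj (θ : ℝ) (p : ℂ × ℝ) : ℂ × ℝ :=
  (cis θ * (projParab (cis (-θ) * p.1, p.2)).1, (projParab (cis (-θ) * p.1, p.2)).2)

/-- The coordinate of (the orthogonal projection of) `z` along the `θ`-axis. -/
def axisCoord (θ : ℝ) (z : ℂ) : ℝ := (cis (-θ) * z).re

/-- The minor circular arc in the half plane `upperHalf θ`, centered on the `θ`-axis, that joins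
two points `z₁, z₂` of `upperHalf θ`.

If the points have different coordinates along the `θ`-axis, there is exactly one circle through
both with its center `c e^{iθ}` on the `θ`-axis. Its part in `upperHalf θ` is a semicircle, which
is a graph over the `θ`-axis, and the minor arc is the portion of this semicircle between
`z₁` and `z₂`. If the coordinates agree, the circle is a line (center at infinity) and the arc is
the straight segment. -/
def thetaArc (θ : ℝ) (z₁ z₂ : ℂ) : Set ℂ :=
  {w | (axisCoord θ z₁ = axisCoord θ z₂ ∧ w ∈ segment ℝ z₁ z₂) ∨
    (axisCoord θ z₁ ≠ axisCoord θ z₂ ∧ w ∈ upperHalf θ ∧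
      axisCoord θ w ∈ Set.uIcc (axisCoord θ z₁) (axisCoord θ z₂) ∧
      ∃ c : ℝ, ‖z₁ - (c : ℂ) * cis θ‖ = ‖z₂ - (c : ℂ) * cis θ‖ ∧
        ‖w - (c : ℂ) * cis θ‖ = ‖z₁ - (c : ℂ) * cis θ‖)}

/-- Reflection across the `θ`-axis. -/
def axisReflect (θ : ℝ) (z : ℂ) : ℂ := cis θ * conj (cis (-θ) * z)

/-- The eigenvalues of `A` folded into `upperHalf θ`: an eigenvalue in `upperHalf θ` is kept and
any other eigenvalue is replaced by its mirror image across the `θ`-axis. -/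
def foldedEigs {n : ℕ} (θ : ℝ) (A : Matrix (Fin n) (Fin n) ℂ) : Set ℂ :=
  {p | p ∈ upperHalf θ ∧ (p ∈ eigs A ∨ axisReflect θ p ∈ eigs A)}

end

end ThetaSRG

open ThetaSRG

/-! Put B = e^{-iθ}A and let W(B) be the set of pairs (Re⟨x,Bx⟩, ‖Bx‖²) with ‖x‖ = 1. A point z lies
in SRG(B) iff `parab z` = (Re z, |z|²) lies in W(B) (`mem_srg_iff`). On the closed upper half plane
`parab` is a homeomorphism onto {t² ≤ r}, with the real axis going to the parabola t² = r. Since |z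
- c|² = r - 2ct + c² is affine in (t, r), arcs centered on the real axis become straight segments
(`parab_mem_segment_iff`). Every claim thus becomes a statement about the planar set W(B).

W(B) is compact, and it is convex because it is the numerical range of (B + B*)/2 + iB*B
(Toeplitz-Hausdorff). This yields the arc property and simple connectedness. W(B) = W(B*): a half
plane containing W(B) amounts to a bound on Re⟨x,Bx⟩ or, after completing the square, an upper or
lower bound on ‖(B+s)x‖, and either kind passes to the adjoint (`quadRange_adjoint`).

A point of W(B) on the parabola is an equality case of Cauchy-Schwarz, hence comes from a real
eigenvalue of B. So SRG_θ(A) meets the θ-axis in eigenvalues only, and letting the axis sweep the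
plane isolates the spectrum.

If B is normal, every linear functional on W(B) is maximized at an eigenvector, so W(B) is the
convex hull of the finite set `parab '' eigs B` (`quadRange_eq_convexHull`). The edges of this
polygon pull back to the boundary arcs. -/

namespace ThetaSRG

/-! ### Planar convex geometry: supporting lines and polygon edges -/

/-- A point of a convex planar set that is not interior has a supporting line. -/
theorem exists_support_of_notMem_interior {W : Set (ℝ × ℝ)} (hW : Convex ℝ W) {x : ℝ × ℝ}
    (hx : x ∈ W) (hxi : x ∉ interior W) :
    ∃ a b : ℝ, 0 < a ^ 2 + b ^ 2 ∧ ∀ p ∈ W, a * p.1 + b * p.2 ≤ a * x.1 + b * x.2 := by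
  obtain ⟨f, hf0, hf⟩ : ∃ f : ℝ × ℝ →ₗ[ℝ] ℝ, f ≠ 0 ∧ ∀ p ∈ W, f p ≤ f x := by
    by_cases hne : (interior W).Nonempty
    · obtain ⟨f, hf0, hf⟩ := geometric_hahn_banach_of_nonempty_interior_point hW hxi hne
      exact ⟨f.toLinearMap, fun h => hf0 (ContinuousLinearMap.coe_injective h), hf⟩
    -- With empty interior, `W` lies in a proper affine subspace, and a nonzero functional vanishing
    -- on its direction is constant on `W`.
    · have h1 : affineSpan ℝ W ≠ ⊤ := by
        rwa [Ne, ← hW.interior_nonempty_iff_affineSpan_eq_top]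
      have h2 : vectorSpan ℝ W < ⊤ := by
        refine lt_top_iff_ne_top.2 fun h => h1 ?_
        exact (AffineSubspace.affineSpan_eq_top_iff_vectorSpan_eq_top_of_nonempty ℝ _ _ ⟨x, hx⟩).2 h
      obtain ⟨f, hf0, hf⟩ := Submodule.exists_le_ker_of_lt_top _ h2
      refine ⟨f, hf0, fun p hp => ?_⟩
      have := hf (vsub_mem_vectorSpan ℝ hp hx)
      rw [LinearMap.mem_ker, vsub_eq_sub, map_sub] at this
      linarith
  have key : ∀ p : ℝ × ℝ, f p = f (1, 0) * p.1 + f (0, 1) * p.2 := fun p => by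
    have : p = p.1 • ((1, 0) : ℝ × ℝ) + p.2 • ((0, 1) : ℝ × ℝ) := by ext <;> simp
    conv_lhs => rw [this, map_add, map_smul, map_smul]
    simp only [smul_eq_mul]; ring
  refine ⟨f (1, 0), f (0, 1), ?_, fun p hp => by rw [← key, ← key]; exact hf p hp⟩
  by_contra h
  have ha : f (1, 0) = 0 := by nlinarith [sq_nonneg (f (1, 0)), sq_nonneg (f (0, 1))]
  have hb : f (0, 1) = 0 := by nlinarith [sq_nonneg (f (1, 0)), sq_nonneg (f (0, 1))]
  exact hf0 (LinearMap.ext fun p => by rw [key, ha, hb]; simp)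

/-- Moving from `x` in the direction `(a, b)` strictly increases the functional, so points
arbitrarily near `x` leave `W`. -/
theorem notMem_interior_of_support {W : Set (ℝ × ℝ)} {x : ℝ × ℝ} {a b : ℝ}
    (hab : 0 < a ^ 2 + b ^ 2) (h : ∀ p ∈ W, a * p.1 + b * p.2 ≤ a * x.1 + b * x.2) :
    x ∉ interior W := by
  intro hx
  have hc : Filter.Tendsto (fun e : ℝ => (x.1 + e * a, x.2 + e * b)) (nhdsWithin 0 (Set.Ioi 0))
      (nhds x) := by
    have : Continuous fun e : ℝ => (x.1 + e * a, x.2 + e * b) := by fun_prop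
    simpa using (this.tendsto 0).mono_left nhdsWithin_le_nhds
  have h1 := hc.eventually (mem_interior_iff_mem_nhds.1 hx)
  obtain ⟨e, he, he0⟩ := (h1.and self_mem_nhdsWithin).exists
  have h2 := h _ he
  have he0 : 0 < e := he0
  simp only at h2
  nlinarith [mul_pos he0 hab]

/-- Rotating a supporting line at a vertex `p` in one sense until it meets another point. -/
theorem exists_edge_of_pos {F : Set (ℝ × ℝ)} (hF : F.Finite) {p : ℝ × ℝ} {a b c d : ℝ}
    (hs : ∀ q ∈ F, a * q.1 + b * q.2 ≤ a * p.1 + b * p.2) (hdet : 0 < (a * d - b * c) ^ 2)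
    (hq : ∃ q ∈ F, c * p.1 + d * p.2 < c * q.1 + d * q.2) :
    ∃ q ∈ F, q ≠ p ∧ ∃ a' b' : ℝ, 0 < a' ^ 2 + b' ^ 2 ∧
      a' * q.1 + b' * q.2 = a' * p.1 + b' * p.2 ∧
      ∀ r ∈ F, a' * r.1 + b' * r.2 ≤ a' * p.1 + b' * p.2 := by
  set f : ℝ × ℝ → ℝ := fun q => a * (p.1 - q.1) + b * (p.2 - q.2) with hf
  set g : ℝ × ℝ → ℝ := fun q => c * (q.1 - p.1) + d * (q.2 - p.2) with hg
  -- The functional `(a + s c, b + s d)` stays maximal at `p` until `s` reaches the least ratio `f /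
  -- g` over points with `g > 0`; the minimizer is the first point hit.
  obtain ⟨q, ⟨hqF, hq0⟩, hmin⟩ := Set.exists_min_image {q ∈ F | 0 < g q} (fun q => f q / g q)
    (hF.subset fun _ h => h.1) (by
      obtain ⟨q, h, h'⟩ := hq
      exact ⟨q, h, by simp only [hg]; linarith⟩)
  have hf0 : ∀ r ∈ F, 0 ≤ f r := fun r hr => by have := hs r hr; simp only [hf]; linarith
  set s := f q / g q with hsdef
  have hs0 : 0 ≤ s := div_nonneg (hf0 q hqF) hq0.le
  have hsq : s * g q = f q := div_mul_cancel₀ _ hq0.ne'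
  refine ⟨q, hqF, ?_, a + s * c, b + s * d, ?_, ?_, ?_⟩
  · rintro rfl
    simp [hg] at hq0
  · by_contra h
    have h1 : a + s * c = 0 := by nlinarith [sq_nonneg (a + s * c), sq_nonneg (b + s * d)]
    have h2 : b + s * d = 0 := by nlinarith [sq_nonneg (a + s * c), sq_nonneg (b + s * d)]
    have : a * d - b * c = 0 := by linear_combination d * h1 - c * h2
    rw [this] at hdet
    simp at hdet
  · simp only [hf, hg] at hsq
    linear_combination hsq
  · intro r hr
    have : s * g r ≤ f r := by
      rcases le_or_gt (g r) 0 with h | h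
      · exact (mul_nonpos_of_nonneg_of_nonpos hs0 h).trans (hf0 r hr)
      · exact (le_div_iff₀ h).1 (hmin r ⟨hr, h⟩)
    simp only [hf, hg] at this
    linarith

/-- Turn the line towards either perpendicular `±(-b, a)`. If neither turn can meet a new point, `F`
lies on the line through `p` with normal `(-b, a)`, which is then itself supporting. -/
theorem exists_edge_of_vertex {F : Set (ℝ × ℝ)} (hF : F.Finite) (hn : F.Nontrivial) {p : ℝ × ℝ}
    {a b : ℝ} (hab : 0 < a ^ 2 + b ^ 2)
    (hs : ∀ q ∈ F, a * q.1 + b * q.2 ≤ a * p.1 + b * p.2) :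
    ∃ q ∈ F, q ≠ p ∧ ∃ a' b' : ℝ, 0 < a' ^ 2 + b' ^ 2 ∧
      a' * q.1 + b' * q.2 = a' * p.1 + b' * p.2 ∧
      ∀ r ∈ F, a' * r.1 + b' * r.2 ≤ a' * p.1 + b' * p.2 := by
  by_cases h1 : ∃ q ∈ F, -b * p.1 + a * p.2 < -b * q.1 + a * q.2
  · exact exists_edge_of_pos hF hs (by nlinarith [pow_pos hab 2]) h1
  by_cases h2 : ∃ q ∈ F, b * p.1 + -a * p.2 < b * q.1 + -a * q.2
  · exact exists_edge_of_pos hF hs (by nlinarith [pow_pos hab 2]) h2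
  push Not at h1 h2
  obtain ⟨q, hq, hqp⟩ := hn.exists_ne p
  refine ⟨q, hq, hqp, -b, a, by nlinarith, ?_, h1⟩
  linarith [h1 q hq, h2 q hq]

/-- The weighted deficits of the functional at the points of `F` are nonnegative and sum to zero, so
only points of zero deficit carry weight. -/
theorem mem_convexHull_face {F : Set (ℝ × ℝ)} (hF : F.Finite) {x : ℝ × ℝ}
    (hx : x ∈ convexHull ℝ F) {a b : ℝ}
    (hs : ∀ q ∈ F, a * q.1 + b * q.2 ≤ a * x.1 + b * x.2) :
    x ∈ convexHull ℝ {q ∈ F | a * q.1 + b * q.2 = a * x.1 + b * x.2} := by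
  rw [hF.convexHull_eq] at hx
  obtain ⟨w, hw0, hw1, hwx⟩ := hx
  rw [Finset.centerMass_eq_of_sum_1 _ _ hw1] at hwx
  have e1 : ∑ q ∈ hF.toFinset, w q * q.1 = x.1 := by
    rw [← hwx]; simp [Prod.fst_sum]
  have e2 : ∑ q ∈ hF.toFinset, w q * q.2 = x.2 := by
    rw [← hwx]; simp [Prod.snd_sum]
  have hz : ∑ q ∈ hF.toFinset, w q * (a * x.1 + b * x.2 - (a * q.1 + b * q.2)) = 0 := by
    have : ∀ q : ℝ × ℝ, w q * (a * x.1 + b * x.2 - (a * q.1 + b * q.2)) =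
      w q * (a * x.1 + b * x.2) - (a * (w q * q.1) + b * (w q * q.2)) := fun q => by ring
    simp only [this, Finset.sum_sub_distrib, Finset.sum_add_distrib, ← Finset.sum_mul,
      ← Finset.mul_sum, hw1, e1, e2]
    ring
  rw [Finset.sum_eq_zero_iff_of_nonneg (fun q hq => mul_nonneg (hw0 q (hF.mem_toFinset.1 hq))
    (sub_nonneg.2 (hs q (hF.mem_toFinset.1 hq))))] at hz
  rw [← Finset.sum_filter_of_ne (p := fun q => w q ≠ 0)
    fun q _ h h0 => h (by rw [h0, zero_smul])] at hwx
  rw [← Finset.sum_filter_of_ne (p := fun q => w q ≠ 0) fun q _ h => h] at hw1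
  suffices h : ∑ q ∈ hF.toFinset with w q ≠ 0, w q • id q ∈
      convexHull ℝ {q ∈ F | a * q.1 + b * q.2 = a * x.1 + b * x.2} by rwa [hwx] at h
  refine (convex_convexHull ℝ _).sum_mem (fun q hq => ?_) hw1 fun q hq => ?_
  · exact hw0 q (hF.mem_toFinset.1 (Finset.mem_filter.1 hq).1)
  · obtain ⟨hq, hq0⟩ := Finset.mem_filter.1 hq
    refine subset_convexHull _ _ ⟨hF.mem_toFinset.1 hq, ?_⟩
    have := (mul_eq_zero.1 (hz q hq)).resolve_left hq0
    simp only [id_eq]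
    linarith

theorem mem_segment_of_collinear {a b : ℝ} (hab : 0 < a ^ 2 + b ^ 2) {p q x : ℝ × ℝ}
    (hp : a * p.1 + b * p.2 = a * x.1 + b * x.2) (hq : a * q.1 + b * q.2 = a * x.1 + b * x.2)
    (hpx : -b * p.1 + a * p.2 ≤ -b * x.1 + a * x.2)
    (hxq : -b * x.1 + a * x.2 ≤ -b * q.1 + a * q.2) : x ∈ segment ℝ p q := by
  rcases eq_or_lt_of_le (hpx.trans hxq) with h | h
  · have h1 : -b * p.1 + a * p.2 = -b * x.1 + a * x.2 := le_antisymm hpx (h ▸ hxq)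
    have : x = p := by
      ext
      · refine mul_left_cancel₀ hab.ne' ?_
        linear_combination b * h1 - a * hp
      · refine mul_left_cancel₀ hab.ne' ?_
        linear_combination - a * h1 - b * hp
    exact this ▸ left_mem_segment ℝ _ _
  · set P := -b * p.1 + a * p.2 with hP
    set Q := -b * q.1 + a * q.2 with hQ
    set X := -b * x.1 + a * x.2 with hX
    have h0 : 0 < Q - P := sub_pos.2 h
    refine ⟨(Q - X) / (Q - P), (X - P) / (Q - P), div_nonneg (by linarith) h0.le,
      div_nonneg (by linarith) h0.le, by field_simp; ring, ?_⟩
    have e : ∀ u v : ℝ, (Q - X) / (Q - P) * u + (X - P) / (Q - P) * v =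
      ((Q - X) * u + (X - P) * v) / (Q - P) := fun u v => by ring
    ext
    · simp only [Prod.fst_add, Prod.smul_fst, smul_eq_mul, e]
      rw [div_eq_iff h0.ne']
      refine mul_left_cancel₀ hab.ne' ?_
      have k1 : (a ^ 2 + b ^ 2) * p.1 = a * (a * x.1 + b * x.2) - b * P := by rw [← hp, hP]; ring
      have k2 : (a ^ 2 + b ^ 2) * q.1 = a * (a * x.1 + b * x.2) - b * Q := by rw [← hq, hQ]; ring
      have k3 : (a ^ 2 + b ^ 2) * x.1 = a * (a * x.1 + b * x.2) - b * X := by rw [hX]; ring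
      linear_combination (Q - X) * k1 + (X - P) * k2 - (Q - P) * k3
    · simp only [Prod.snd_add, Prod.smul_snd, smul_eq_mul, e]
      rw [div_eq_iff h0.ne']
      refine mul_left_cancel₀ hab.ne' ?_
      have k1 : (a ^ 2 + b ^ 2) * p.2 = b * (a * x.1 + b * x.2) + a * P := by rw [← hp, hP]; ring
      have k2 : (a ^ 2 + b ^ 2) * q.2 = b * (a * x.1 + b * x.2) + a * Q := by rw [← hq, hQ]; ring
      have k3 : (a ^ 2 + b ^ 2) * x.2 = b * (a * x.1 + b * x.2) + a * X := by rw [hX]; ring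
      linear_combination (Q - X) * k1 + (X - P) * k2 - (Q - P) * k3

/-- The frontier of a convex polygon is a union of edges joining distinct points. -/
theorem frontier_convexHull_finite {F : Set (ℝ × ℝ)} (hF : F.Finite) (hn : F.Nontrivial) :
    ∃ P ⊆ F.offDiag, frontier (convexHull ℝ F) = ⋃ p ∈ P, segment ℝ p.1 p.2 := by
  have hcl : IsClosed (convexHull ℝ F) := hF.isClosed_convexHull ℝ
  refine ⟨{p | p ∈ F.offDiag ∧ segment ℝ p.1 p.2 ⊆ frontier (convexHull ℝ F)}, fun p h => h.1,
    Set.Subset.antisymm ?_ (Set.iUnion₂_subset fun p h => h.2)⟩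
  have edge : ∀ p ∈ F, ∀ q ∈ F, p ≠ q → ∀ a b : ℝ, 0 < a ^ 2 + b ^ 2 →
      a * q.1 + b * q.2 = a * p.1 + b * p.2 →
      (∀ r ∈ F, a * r.1 + b * r.2 ≤ a * p.1 + b * p.2) → ∀ x ∈ segment ℝ p q,
      x ∈ ⋃ p ∈ {p | p ∈ F.offDiag ∧ segment ℝ p.1 p.2 ⊆ frontier (convexHull ℝ F)},
        segment ℝ p.1 p.2 := by
    intro p hp q hq hpq a b hab he hs x hx
    refine Set.mem_iUnion₂.2 ⟨(p, q), ⟨⟨hp, hq, hpq⟩, fun y hy => ?_⟩, hx⟩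
    rw [hcl.frontier_eq]
    refine ⟨segment_subset_convexHull hp hq hy, notMem_interior_of_support hab (a := a) (b := b) ?_⟩
    have hy' : a * y.1 + b * y.2 = a * p.1 + b * p.2 := by
      obtain ⟨s, t, -, -, hst, rfl⟩ := hy
      simp only [Prod.fst_add, Prod.snd_add, Prod.smul_fst, Prod.smul_snd, smul_eq_mul]
      linear_combination t * he + (a * p.1 + b * p.2) * hst
    rw [hy']
    have hlin : IsLinearMap ℝ fun r : ℝ × ℝ => a * r.1 + b * r.2 :=
      ⟨fun u v => by simp only [Prod.fst_add, Prod.snd_add]; ring,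
        fun c u => by simp only [Prod.smul_fst, Prod.smul_snd, smul_eq_mul]; ring⟩
    exact convexHull_min (fun r hr => hs r hr) (convex_halfSpace_le hlin _)
  intro x hx
  rw [hcl.frontier_eq] at hx
  obtain ⟨a, b, hab, hs⟩ := exists_support_of_notMem_interior (convex_convexHull ℝ F) hx.1 hx.2
  have hsF : ∀ q ∈ F, a * q.1 + b * q.2 ≤ a * x.1 + b * x.2 :=
    fun q hq => hs q (subset_convexHull _ _ hq)
  have hface := mem_convexHull_face hF hx.1 hsF
  -- `g` is a coordinate along the supporting line; points of `F` on that line with extreme `g`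
  -- enclose `x`.
  let g : ℝ × ℝ →ₗ[ℝ] ℝ := (-b) • LinearMap.fst ℝ ℝ ℝ + a • LinearMap.snd ℝ ℝ ℝ
  obtain ⟨q, ⟨hq, hqe⟩, hxq⟩ := (g.convexOn (convex_univ)).exists_ge_of_mem_convexHull
    (Set.subset_univ _) hface
  obtain ⟨p, ⟨hp, hpe⟩, hpx⟩ := (g.concaveOn (convex_univ)).exists_le_of_mem_convexHull
    (Set.subset_univ _) hface
  have hseg : x ∈ segment ℝ p q := mem_segment_of_collinear hab hpe hqe (by simpa [g] using hpx)
    (by simpa [g] using hxq)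
  rcases eq_or_ne p q with rfl | hpq
  -- Here `x` is itself a point of `F` and yields no edge directly, so the supporting line is
  -- rotated about it.
  · rw [segment_same, Set.mem_singleton_iff] at hseg
    subst hseg
    obtain ⟨q, hq, hqp, a', b', hab', he, hs'⟩ := exists_edge_of_vertex hF hn hab hsF
    exact edge x hp q hq hqp.symm a' b' hab' he hs' x (left_mem_segment ℝ _ _)
  · exact edge p hp q hq hpq a b hab (hqe.trans hpe.symm) (by rw [hpe]; exact hsF) x hseg

end ThetaSRG

namespace ThetaSRG

/-! ### The planar range of (Re⟨x,Tx⟩, ‖Tx‖²): convexity, adjoints, normal operators -/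

section QuadRange

variable {E : Type*} [NormedAddCommGroup E] [InnerProductSpace ℂ E]

/-- The imaginary part is a real-linear functional of `u ∈ ℂ ≅ ℝ²`, so it has a nonzero kernel; `w`
is a kernel vector read off from its coefficients. -/
theorem exists_unimodular_im_eq_zero (β γ : ℂ) :
    ∃ u : ℂ, ‖u‖ = 1 ∧ (conj u * β + u * γ).im = 0 := by
  set w : ℂ := ⟨β.re - γ.re, β.im + γ.im⟩ with hw
  by_cases h : w = 0
  · refine ⟨1, by simp, ?_⟩
    have := congrArg Complex.im h
    simpa [hw] using this
  · have hn : (‖w‖ : ℂ) ≠ 0 := by simpa using h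
    refine ⟨w / ‖w‖, by simp [h], ?_⟩
    have : conj (w / ‖w‖) * β + w / ‖w‖ * γ = ((‖w‖⁻¹ : ℝ) : ℂ) * (conj w * β + w * γ) := by
      rw [map_div₀, Complex.conj_ofReal, Complex.ofReal_inv]
      field_simp
    rw [this, Complex.im_ofReal_mul]
    simp only [hw, Complex.add_im, Complex.mul_im, Complex.conj_re, Complex.conj_im]
    ring

/-- The **Toeplitz-Hausdorff theorem**: the numerical range of a linear operator is convex. -/
theorem convex_numericalRange (M : E →ₗ[ℂ] E) :
    Convex ℝ ((fun x : E => inner ℂ x (M x)) '' Metric.sphere 0 1) := by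
  rintro _ ⟨x, hx, rfl⟩ _ ⟨y, hy, rfl⟩ a b ha hb hab
  rw [mem_sphere_zero_iff_norm] at hx hy
  simp only
  set p := inner ℂ x (M x) with hp
  set q := inner ℂ y (M y) with hq
  by_cases hpq : p = q
  · refine ⟨x, by simpa using hx, ?_⟩
    rw [← hpq, ← add_smul, hab, one_smul]
  have hqp : q - p ≠ 0 := sub_ne_zero.2 (Ne.symm hpq)
  -- Affine normalization: the form of `K` takes the values 0 at `x` and 1 at `y`.
  let K : E →ₗ[ℂ] E := (q - p)⁻¹ • (M - p • LinearMap.id)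
  have hK : ∀ z : E, inner ℂ z (M z) = (q - p) * inner ℂ z (K z) + p * (‖z‖ ^ 2 : ℝ) := fun z => by
    simp only [K, LinearMap.smul_apply, LinearMap.sub_apply, LinearMap.id_apply, inner_smul_right,
      inner_sub_right, inner_self_eq_norm_sq_to_K]
    rw [mul_inv_cancel_left₀ hqp]
    simp
  have hxK : inner ℂ x (K x) = 0 := by
    have := hK x
    rw [hx, ← hp] at this
    simpa [hqp] using this
  have hyK : inner ℂ y (K y) = 1 := by
    have := hK y
    rw [hy, ← hq] at this
    refine mul_left_cancel₀ hqp ?_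
    simp only [one_pow, Complex.ofReal_one, mul_one] at this ⊢
    linear_combination -this
  obtain ⟨u, hu, huim⟩ := exists_unimodular_im_eq_zero (inner ℂ x (K y)) (inner ℂ y (K x))
  set R := (conj u * inner ℂ x (K y) + u * inner ℂ y (K x)).re with hR
  have hRc : conj u * inner ℂ x (K y) + u * inner ℂ y (K x) = (R : ℂ) :=
    Complex.ext (by simp [hR]) (by simpa using huim)
  -- The phase `u` makes the cross term real, so the form of `K` is real along this path from `u •
  -- x` to `y`. The intermediate value theorem then gives its quotient by `‖v s‖ ^ 2` the value `b`.
  let v : ℝ → E := fun s => (((1 - s : ℝ) : ℂ) * u) • x + (s : ℂ) • y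
  have hv : ∀ s, inner ℂ (v s) (K (v s)) = ((s ^ 2 + s * (1 - s) * R : ℝ) : ℂ) := fun s => by
    simp only [v, map_add, map_smul, inner_add_left, inner_add_right, inner_smul_left,
      inner_smul_right, hxK, hyK, map_mul, Complex.conj_ofReal]
    push_cast
    linear_combination (s : ℂ) * (1 - s) * hRc
  have hvc : Continuous v := by fun_prop
  obtain ⟨s, -, hs⟩ : ∃ s ∈ Set.Icc (0 : ℝ) 1,
      s ^ 2 + s * (1 - s) * R - b * ‖v s‖ ^ 2 = 0 := by
    refine intermediate_value_Icc zero_le_one (by fun_prop) ?_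
    simp [v, hx, hy, hu, norm_smul]
    constructor <;> linarith
  -- If `v s = 0`, the form of `K` agrees on `(1 - s) u x` and `-s y`, so `0 = s ^ 2`; then `u x =
  -- 0`, which is absurd.
  have hv0 : v s ≠ 0 := fun h => by
    have h1 : ((s ^ 2 + s * (1 - s) * R : ℝ) : ℂ) = 0 := by rw [← hv, h]; simp
    have h2 : (((1 - s : ℝ) : ℂ) * u) • x = -((s : ℂ) • y) := eq_neg_of_add_eq_zero_left h
    have h3 : inner ℂ ((((1 - s : ℝ) : ℂ) * u) • x) (K ((((1 - s : ℝ) : ℂ) * u) • x)) =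
      inner ℂ (-((s : ℂ) • y)) (K (-((s : ℂ) • y))) := by rw [h2]
    simp only [map_neg, map_smul, inner_neg_left, inner_neg_right, inner_smul_left,
      inner_smul_right, hxK, hyK, Complex.conj_ofReal] at h3
    have h4 : s = 0 := by
      simp at h3
      exact h3
    rw [h4] at h2
    have h5 : u • x = 0 := by simpa using h2
    have := congrArg norm h5
    rw [norm_smul, hu, hx] at this
    simp at this
  have hvn : ‖v s‖ ≠ 0 := norm_ne_zero_iff.2 hv0
  refine ⟨((‖v s‖⁻¹ : ℝ) : ℂ) • v s, ?_, ?_⟩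
  · simp [norm_smul, hvn]
  · simp only [map_smul, inner_smul_left, inner_smul_right, Complex.conj_ofReal]
    rw [hK, hv, sub_eq_zero.1 hs, Complex.real_smul, Complex.real_smul]
    have hvn' : (‖v s‖ : ℂ) ≠ 0 := by exact_mod_cast hvn
    have hab' : (a : ℂ) + b = 1 := by exact_mod_cast hab
    push_cast
    field_simp
    linear_combination (- p) * hab'

/-- The set of pairs `(Re ⟨x, T x⟩, ‖T x‖ ^ 2)`, for `x` a unit vector. -/
def quadRange (T : E →ₗ[ℂ] E) : Set (ℝ × ℝ) :=
  (fun x : E => ((inner ℂ x (T x)).re, ‖T x‖ ^ 2)) '' Metric.sphere 0 1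

theorem mem_quadRange_iff {T : E →ₗ[ℂ] E} {p : ℝ × ℝ} :
    p ∈ quadRange T ↔ ∃ x : E, x ≠ 0 ∧ (inner ℂ x (T x)).re = p.1 * ‖x‖ ^ 2 ∧
      ‖T x‖ ^ 2 = p.2 * ‖x‖ ^ 2 := by
  constructor
  · rintro ⟨x, hx, rfl⟩
    rw [mem_sphere_zero_iff_norm] at hx
    exact ⟨x, norm_ne_zero_iff.1 (by simp [hx]), by simp [hx], by simp [hx]⟩
  · rintro ⟨x, hx, h1, h2⟩
    have hn : ‖x‖ ≠ 0 := norm_ne_zero_iff.2 hx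
    refine ⟨((‖x‖⁻¹ : ℝ) : ℂ) • x, by simp [norm_smul, hn], ?_⟩
    ext
    · simp only [map_smul, inner_smul_left, inner_smul_right, Complex.conj_ofReal,
        Complex.re_ofReal_mul, h1]
      field_simp
    · simp only [map_smul, norm_smul, mul_pow, h2]
      simp
      field_simp

/-- The point of the parabolic region `{(t, r) | t ^ 2 ≤ r}` that represents `z`. -/
noncomputable def parab (z : ℂ) : ℝ × ℝ := (z.re, ‖z‖ ^ 2)

theorem parab_mem_quadRange_of_hasEigenvalue {T : E →ₗ[ℂ] E} {l : ℂ}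
    (hl : Module.End.HasEigenvalue T l) : parab l ∈ quadRange T := by
  obtain ⟨x, hx⟩ := hl.exists_hasEigenvector
  refine mem_quadRange_iff.2 ⟨x, hx.2, ?_, ?_⟩
  · rw [hx.apply_eq_smul, inner_smul_right, inner_self_eq_norm_sq_to_K]
    simp [parab, ← Complex.ofReal_pow]
  · rw [hx.apply_eq_smul, norm_smul, mul_pow, parab]

theorem norm_add_smul_sq (T : E →ₗ[ℂ] E) (s : ℝ) (x : E) :
    ‖T x + (s : ℂ) • x‖ ^ 2 = ‖T x‖ ^ 2 + 2 * s * (inner ℂ x (T x)).re + s ^ 2 * ‖x‖ ^ 2 := by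
  have h : (inner ℂ (T x) x).re = (inner ℂ x (T x)).re := inner_re_symm (𝕜 := ℂ) _ _
  rw [norm_add_sq (𝕜 := ℂ), inner_smul_right, norm_smul, mul_pow]
  simp [h]
  ring

variable [FiniteDimensional ℂ E]

theorem convex_quadRange (T : E →ₗ[ℂ] E) : Convex ℝ (quadRange T) := by
  -- The Hermitian part of `T` has form `Re ⟨x, T x⟩`, and `T* T` has form `‖T x‖ ^ 2`.
  let M : E →ₗ[ℂ] E := (2⁻¹ : ℂ) • (T + T.adjoint) + Complex.I • (T.adjoint ∘ₗ T)
  have hM : ∀ x, inner ℂ x (M x) = ⟨(inner ℂ x (T x)).re, ‖T x‖ ^ 2⟩ := fun x => by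
    simp only [M, LinearMap.add_apply, LinearMap.smul_apply, LinearMap.comp_apply,
      inner_add_right, inner_smul_right, LinearMap.adjoint_inner_right,
      inner_self_eq_norm_sq_to_K]
    have h1 : (inner ℂ (T x) x).re = (inner ℂ x (T x)).re := inner_re_symm (𝕜 := ℂ) _ _
    have h2 : (inner ℂ (T x) x).im = -(inner ℂ x (T x)).im := inner_im_symm (𝕜 := ℂ) _ _
    apply Complex.ext <;> simp [← Complex.ofReal_pow, h1, h2]
    ring
  have h := (convex_numericalRange M).linear_image Complex.equivRealProdLm.toLinearMap
  rw [Set.image_image] at h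
  rintro _ ⟨x, hx, rfl⟩ _ ⟨y, hy, rfl⟩ a b ha hb hab
  obtain ⟨z, hz, hze⟩ := h ⟨x, hx, rfl⟩ ⟨y, hy, rfl⟩ ha hb hab
  simp only [hM] at hze
  exact ⟨z, hz, hze⟩

theorem isCompact_quadRange (T : E →ₗ[ℂ] E) : IsCompact (quadRange T) := by
  have : ProperSpace E := FiniteDimensional.proper_rclike ℂ E
  have hT : Continuous T := T.continuous_of_finiteDimensional
  exact (isCompact_sphere 0 1).image (by fun_prop)

theorem exists_separating {W : Set (ℝ × ℝ)} (hc : Convex ℝ W) (hcl : IsClosed W) {p : ℝ × ℝ}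
    (hp : p ∉ W) : ∃ a b u : ℝ, (∀ q ∈ W, a * q.1 + b * q.2 < u) ∧ u < a * p.1 + b * p.2 := by
  obtain ⟨f, u, h1, h2⟩ := geometric_hahn_banach_closed_point hc hcl hp
  have key : ∀ p : ℝ × ℝ, f p = f (1, 0) * p.1 + f (0, 1) * p.2 := fun p => by
    have : p = p.1 • ((1, 0) : ℝ × ℝ) + p.2 • ((0, 1) : ℝ × ℝ) := by ext <;> simp
    conv_lhs => rw [this, map_add, map_smul, map_smul]
    simp only [smul_eq_mul]; ring
  exact ⟨f (1, 0), f (0, 1), u, fun q hq => key q ▸ h1 q hq, key p ▸ h2⟩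

/-- Cauchy-Schwarz on `‖R* x‖² = ⟨R R* x, x⟩`, with the bound applied at `R* x`. -/
theorem norm_adjoint_sq_le {R : E →ₗ[ℂ] E} {k : ℝ} (h : ∀ y, ‖R y‖ ^ 2 ≤ k * ‖y‖ ^ 2) (x : E) :
    ‖R.adjoint x‖ ^ 2 ≤ k * ‖x‖ ^ 2 := by
  rcases eq_or_ne (R.adjoint x) 0 with h0 | h0
  · rcases eq_or_ne x 0 with rfl | hx
    · simp
    · rw [h0]
      simpa using (sq_nonneg _).trans (h x)
  have hpos : 0 < ‖R.adjoint x‖ ^ 2 := by positivity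
  have h1 : ‖R.adjoint x‖ ^ 2 ≤ ‖R (R.adjoint x)‖ * ‖x‖ := by
    have h2 := norm_inner_le_norm (𝕜 := ℂ) (R (R.adjoint x)) x
    rw [← LinearMap.adjoint_inner_right, inner_self_eq_norm_sq_to_K] at h2
    simpa using h2
  have h3 := h (R.adjoint x)
  have h4 : (‖R.adjoint x‖ ^ 2) ^ 2 ≤ (‖R (R.adjoint x)‖ * ‖x‖) ^ 2 := by gcongr
  refine le_of_mul_le_mul_left ?_ hpos
  calc _ = (‖R.adjoint x‖ ^ 2) ^ 2 := by ring
    _ ≤ _ := h4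
    _ = ‖R (R.adjoint x)‖ ^ 2 * ‖x‖ ^ 2 := by ring
    _ ≤ (k * ‖R.adjoint x‖ ^ 2) * ‖x‖ ^ 2 := by gcongr
    _ = _ := by ring

/-- For `k > 0` the map `R` is injective, hence surjective in finite dimension. Writing `x = R z`,
Cauchy-Schwarz applies to `‖R z‖² = ⟨z, R* R z⟩`. -/
theorem le_norm_adjoint_sq {R : E →ₗ[ℂ] E} {k : ℝ} (h : ∀ y, k * ‖y‖ ^ 2 ≤ ‖R y‖ ^ 2) (x : E) :
    k * ‖x‖ ^ 2 ≤ ‖R.adjoint x‖ ^ 2 := by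
  rcases le_or_gt k 0 with hk | hk
  · exact (mul_nonpos_of_nonpos_of_nonneg hk (sq_nonneg _)).trans (sq_nonneg _)
  have hinj : Function.Injective R := by
    rw [injective_iff_map_eq_zero]
    intro y hy
    have := h y
    rw [hy, norm_zero] at this
    by_contra hy0
    have : 0 < k * ‖y‖ ^ 2 := by positivity
    linarith
  obtain ⟨z, rfl⟩ := LinearMap.injective_iff_surjective.1 hinj x
  have h1 : ‖R z‖ ^ 2 ≤ ‖z‖ * ‖R.adjoint (R z)‖ := by
    have h2 := norm_inner_le_norm (𝕜 := ℂ) z (R.adjoint (R z))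
    rw [LinearMap.adjoint_inner_right, inner_self_eq_norm_sq_to_K] at h2
    simpa using h2
  rcases eq_or_ne (R z) 0 with h0 | h0
  · simp [h0]
  have hpos : 0 < ‖R z‖ ^ 2 := by positivity
  have h4 : (‖R z‖ ^ 2) ^ 2 ≤ (‖z‖ * ‖R.adjoint (R z)‖) ^ 2 := by gcongr
  have h5 := h z
  refine le_of_mul_le_mul_left ?_ hpos
  calc _ = k * (‖R z‖ ^ 2) ^ 2 := by ring
    _ ≤ k * (‖z‖ * ‖R.adjoint (R z)‖) ^ 2 := by gcongr
    _ = (k * ‖z‖ ^ 2) * ‖R.adjoint (R z)‖ ^ 2 := by ring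
    _ ≤ _ := by gcongr

theorem quadRange_adjoint_subset (T : E →ₗ[ℂ] E) : quadRange T.adjoint ⊆ quadRange T := by
  rintro _ ⟨x, hx, rfl⟩
  by_contra hp
  obtain ⟨a, b, u, h1, h2⟩ := exists_separating (convex_quadRange T) (isCompact_quadRange T).isClosed hp
  have hre : (inner ℂ x (T.adjoint x)).re = (inner ℂ x (T x)).re := by
    rw [LinearMap.adjoint_inner_right, ← inner_conj_symm, Complex.conj_re]
  have h1' : ∀ y : E, a * (inner ℂ y (T y)).re + b * ‖T y‖ ^ 2 ≤ u * ‖y‖ ^ 2 := by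
    intro y
    rcases eq_or_ne y 0 with rfl | hy
    · simp
    have hn : ‖y‖ ^ 2 ≠ 0 := by simpa using hy
    have := h1 ((inner ℂ y (T y)).re / ‖y‖ ^ 2, ‖T y‖ ^ 2 / ‖y‖ ^ 2)
      (mem_quadRange_iff.2 ⟨y, hy, by field_simp, by field_simp⟩)
    have h3 : a * (inner ℂ y (T y)).re + b * ‖T y‖ ^ 2 = (a * ((inner ℂ y (T y)).re / ‖y‖ ^ 2) +
      b * (‖T y‖ ^ 2 / ‖y‖ ^ 2)) * ‖y‖ ^ 2 := by field_simp
    rw [h3]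
    gcongr
  have hx1 : ‖x‖ = 1 := by simpa using hx
  simp only [hre] at h2
  have hx2 := h1' x
  rw [hx1] at hx2
  rcases eq_or_ne b 0 with rfl | hb
  · linarith
  -- Completing the square turns the separating inequality into a bound on `‖(T + s) y‖²`: from
  -- above if `b > 0`, from below if `b < 0`.
  set s : ℝ := a / (2 * b) with hs
  have hbs : 2 * b * s = a := by rw [hs]; field_simp
  let R : E →ₗ[ℂ] E := T + (s : ℂ) • LinearMap.id
  have hR : ∀ y, ‖R y‖ ^ 2 = ‖T y‖ ^ 2 + 2 * s * (inner ℂ y (T y)).re + s ^ 2 * ‖y‖ ^ 2 :=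
    fun y => norm_add_smul_sq T s y
  have hRa : ‖R.adjoint x‖ ^ 2 = ‖T.adjoint x‖ ^ 2 + 2 * s * (inner ℂ x (T x)).re + s ^ 2 := by
    have : R.adjoint x = T.adjoint x + (s : ℂ) • x := by
      refine ext_inner_right ℂ fun y => ?_
      rw [LinearMap.adjoint_inner_left]
      simp only [R, LinearMap.add_apply, LinearMap.smul_apply, LinearMap.id_apply, inner_add_left,
        inner_add_right, inner_smul_left, inner_smul_right, LinearMap.adjoint_inner_left,
        Complex.conj_ofReal]
    rw [this, norm_add_smul_sq, hre, hx1]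
    ring
  have hbR : ∀ y, b * ‖R y‖ ^ 2 ≤ (u + b * s ^ 2) * ‖y‖ ^ 2 := fun y => by
    rw [hR]
    have := h1' y
    rw [← hbs] at this
    nlinarith
  have hk : (u + b * s ^ 2) / b * b = u + b * s ^ 2 := div_mul_cancel₀ _ hb
  rw [← hbs] at h2
  rcases lt_or_gt_of_ne hb with hb | hb
  · have := le_norm_adjoint_sq (R := R) (k := (u + b * s ^ 2) / b) (fun y => by
      have := hbR y
      rw [← hk] at this
      nlinarith) x
    rw [hx1, hRa] at this
    nlinarith
  · have := norm_adjoint_sq_le (R := R) (k := (u + b * s ^ 2) / b) (fun y => by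
      have := hbR y
      rw [← hk] at this
      nlinarith) x
    rw [hx1, hRa] at this
    nlinarith

theorem quadRange_adjoint (T : E →ₗ[ℂ] E) : quadRange T.adjoint = quadRange T :=
  (quadRange_adjoint_subset T).antisymm (by
    simpa using quadRange_adjoint_subset T.adjoint)

/-- A real combination of `Re ⟨x, T x⟩` and `‖T x‖ ^ 2` is maximized at an eigenvector if `T` is
normal. -/
theorem exists_hasEigenvalue_ge {T : E →ₗ[ℂ] E} (hT : Commute T.adjoint T) (a b : ℝ) {x : E}
    (hx : ‖x‖ = 1) : ∃ l, Module.End.HasEigenvalue T l ∧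
      a * (inner ℂ x (T x)).re + b * ‖T x‖ ^ 2 ≤ a * (parab l).1 + b * (parab l).2 := by
  let G : E →ₗ[ℂ] E := ((a / 2 : ℝ) : ℂ) • (T + T.adjoint) + (b : ℂ) • (T.adjoint * T)
  have hG : ∀ y z, inner ℂ y (G z) = ((a / 2 : ℝ) : ℂ) * (inner ℂ y (T z) + inner ℂ (T y) z) +
      (b : ℂ) * inner ℂ (T y) (T z) := fun y z => by
    simp only [G, LinearMap.add_apply, LinearMap.smul_apply, Module.End.mul_apply,
      inner_add_right, inner_smul_right, LinearMap.adjoint_inner_right]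
  have hsym : G.IsSymmetric := fun y z => by
    rw [← inner_conj_symm, hG, hG]
    simp only [map_add, map_mul, Complex.conj_ofReal, inner_conj_symm]
    ring
  have hGre : ∀ y, (inner ℂ (G y) y).re = a * (inner ℂ y (T y)).re + b * ‖T y‖ ^ 2 := fun y => by
    have h : (inner ℂ (T y) y).re = (inner ℂ y (T y)).re := inner_re_symm (𝕜 := ℂ) _ _
    rw [hsym, hG, inner_self_eq_norm_sq_to_K]
    simp [← Complex.ofReal_pow, h]
    ring
  have hcomm : Commute G T := by
    refine Commute.add_left (Commute.smul_left ((Commute.refl T).add_left hT) _)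
      (Commute.smul_left (hT.mul_left (Commute.refl T)) _)
  have : Nontrivial E := ⟨x, 0, norm_ne_zero_iff.1 (by simp [hx])⟩
  have hev := hsym.hasEigenvalue_iSup_of_finiteDimensional
  set μ : ℝ := ⨆ y : { y : E // y ≠ 0 }, RCLike.re (inner ℂ (G y) (y : E)) / ‖(y : E)‖ ^ 2 with hμ
  have hbdd : BddAbove (Set.range fun y : { y : E // y ≠ 0 } =>
      RCLike.re (inner ℂ (G y) (y : E)) / ‖(y : E)‖ ^ 2) := by
    refine ⟨‖LinearMap.toContinuousLinearMap G‖, ?_⟩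
    rintro _ ⟨y, rfl⟩
    exact (le_abs_self _).trans ((LinearMap.toContinuousLinearMap G).rayleighQuotient_le_norm y)
  have hxμ : a * (inner ℂ x (T x)).re + b * ‖T x‖ ^ 2 ≤ μ := by
    refine le_trans ?_ (le_ciSup hbdd ⟨x, norm_ne_zero_iff.1 (by simp [hx])⟩)
    rw [← hGre]
    simp [hx]
  -- The top eigenspace of `G` is `T`-invariant since `G` commutes with `T`, so it contains an
  -- eigenvector of `T`.
  let V := Module.End.eigenspace G (μ : ℂ)
  have hV : ∀ v ∈ V, T v ∈ V := fun v hv => by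
    rw [Module.End.mem_eigenspace_iff] at hv ⊢
    rw [← Module.End.mul_apply, hcomm.eq, Module.End.mul_apply, hv, map_smul]
  have : Nontrivial V := Submodule.nontrivial_iff_ne_bot.2 hev
  obtain ⟨l, hl⟩ := Module.End.exists_eigenvalue (T.restrict hV)
  obtain ⟨v, hv⟩ := hl.exists_hasEigenvector
  have hv0 : (v : E) ≠ 0 := by simpa using hv.2
  have hTv : T v = l • (v : E) := by simpa using congrArg Subtype.val hv.apply_eq_smul
  refine ⟨l, Module.End.hasEigenvalue_of_hasEigenvector
    ⟨Module.End.mem_eigenspace_iff.2 hTv, hv0⟩, hxμ.trans (le_of_eq ?_)⟩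
  have h1 := hGre v
  rw [Module.End.mem_eigenspace_iff.1 v.2, hTv, inner_smul_left, inner_smul_right, norm_smul,
    inner_self_eq_norm_sq_to_K] at h1
  have hn : ‖(v : E)‖ ^ 2 ≠ 0 := by simpa using hv0
  refine mul_right_cancel₀ hn ?_
  simp [← Complex.ofReal_pow] at h1
  simp only [parab]
  linarith

theorem quadRange_eq_convexHull {T : E →ₗ[ℂ] E} (hT : Commute T.adjoint T) :
    quadRange T = convexHull ℝ (parab '' {l | Module.End.HasEigenvalue T l}) := by
  refine Set.Subset.antisymm ?_ (convexHull_min ?_ (convex_quadRange T))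
  · rintro _ ⟨x, hx, rfl⟩
    by_contra hp
    have hfin : (parab '' {l | Module.End.HasEigenvalue T l}).Finite :=
      (Module.End.finite_hasEigenvalue T).image _
    obtain ⟨a, b, u, h1, h2⟩ := exists_separating (convex_convexHull ℝ _)
      (hfin.isClosed_convexHull ℝ) hp
    obtain ⟨l, hl, h3⟩ := exists_hasEigenvalue_ge hT a b (by simpa using hx)
    exact absurd (h1 _ (subset_convexHull _ _ ⟨l, hl, rfl⟩)) (not_lt.2 (h2.le.trans h3))
  · rintro _ ⟨l, hl, rfl⟩
    exact parab_mem_quadRange_of_hasEigenvalue hl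

end QuadRange

end ThetaSRG

namespace ThetaSRG

/-! ### Equality in Cauchy-Schwarz and scaling -/

section QuadRangeMore

variable {E : Type*} [NormedAddCommGroup E] [InnerProductSpace ℂ E]

theorem eq_smul_of_norm_eq {x y : E} {l : ℂ} (h1 : (conj l * inner ℂ x y).re = ‖l‖ ^ 2 * ‖x‖ ^ 2)
    (h2 : ‖y‖ ^ 2 = ‖l‖ ^ 2 * ‖x‖ ^ 2) : y = l • x := by
  have h : ‖y - l • x‖ ^ 2 = 0 := by
    have h3 : (inner ℂ y (l • x)).re = (conj l * inner ℂ x y).re := by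
      rw [← inner_smul_left]
      exact inner_re_symm (𝕜 := ℂ) _ _
    rw [norm_sub_sq (𝕜 := ℂ), norm_smul, mul_pow, h2]
    simp only [RCLike.re_to_complex, h3, h1]
    ring
  exact sub_eq_zero.1 (norm_eq_zero.1 (pow_eq_zero_iff two_ne_zero |>.1 h))

theorem sq_le_of_mem_quadRange {T : E →ₗ[ℂ] E} {p : ℝ × ℝ} (hp : p ∈ quadRange T) :
    p.1 ^ 2 ≤ p.2 := by
  obtain ⟨x, hx, rfl⟩ := hp
  have h1 := (Complex.abs_re_le_norm _).trans (norm_inner_le_norm (𝕜 := ℂ) x (T x))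
  rw [mem_sphere_zero_iff_norm.1 hx, one_mul] at h1
  exact sq_le_sq.2 (by simpa using h1)

theorem parab_conj (z : ℂ) : parab (conj z) = parab z := by simp [parab]

theorem parab_injOn : Set.InjOn parab {z | 0 ≤ z.im} := by
  intro z hz w hw h
  have h1 : z.re = w.re := congrArg Prod.fst h
  have h2 : ‖z‖ ^ 2 = ‖w‖ ^ 2 := congrArg Prod.snd h
  rw [← Complex.normSq_eq_norm_sq, ← Complex.normSq_eq_norm_sq, Complex.normSq_apply,
    Complex.normSq_apply, h1] at h2
  have hz : 0 ≤ z.im := hz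
  have hw : 0 ≤ w.im := hw
  exact Complex.ext h1 ((mul_self_inj hz hw).1 (by linarith))

theorem parab_real_mul_mem_iff {T : E →ₗ[ℂ] E} {c : ℝ} (hc : c ≠ 0) {z : ℂ} :
    parab ((c : ℂ) * z) ∈ quadRange ((c : ℂ) • T) ↔ parab z ∈ quadRange T := by
  simp only [mem_quadRange_iff, parab, LinearMap.smul_apply, inner_smul_right,
    Complex.re_ofReal_mul, norm_smul, norm_mul, mul_pow, mul_assoc]
  refine exists_congr fun x => and_congr_right fun _ => and_congr ?_ ?_
  · exact mul_right_inj' hc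
  · exact mul_right_inj' (by simpa using hc)

/-- For real `l` the point `parab l` lies on the parabola, where Cauchy-Schwarz is an equality. -/
theorem hasEigenvalue_of_real {T : E →ₗ[ℂ] E} {l : ℂ} (hl : l.im = 0)
    (h : parab l ∈ quadRange T) : ∃ x, x ≠ 0 ∧ T x = l • x := by
  obtain ⟨x, hx, h1, h2⟩ := mem_quadRange_iff.1 h
  refine ⟨x, hx, eq_smul_of_norm_eq ?_ h2⟩
  rw [← Complex.normSq_eq_norm_sq, Complex.normSq_apply, hl, Complex.mul_re]
  simp [hl, h1, parab]
  ring

end QuadRangeMore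

/-! ### Rotations and half planes -/

section Cis

theorem cis_add (α β : ℝ) : cis (α + β) = cis α * cis β := by
  simp [cis, mul_add, Complex.exp_add]

theorem cis_zero : cis 0 = 1 := by simp [cis]

theorem cis_mul_cis_neg (θ : ℝ) : cis θ * cis (-θ) = 1 := by
  rw [← cis_add, add_neg_cancel, cis_zero]

theorem cis_neg_mul_cis (θ : ℝ) : cis (-θ) * cis θ = 1 := by
  rw [← cis_add, neg_add_cancel, cis_zero]

theorem cis_ne_zero (θ : ℝ) : cis θ ≠ 0 := Complex.exp_ne_zero _

theorem norm_cis (θ : ℝ) : ‖cis θ‖ = 1 := by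
  rw [cis, mul_comm]; exact Complex.norm_exp_ofReal_mul_I θ

theorem conj_cis (θ : ℝ) : conj (cis θ) = cis (-θ) := by
  rw [cis, cis, ← Complex.exp_conj]; simp

theorem cis_pi : cis Real.pi = -1 := by rw [cis, mul_comm]; exact Complex.exp_pi_mul_I

theorem cis_neg_add_pi (θ : ℝ) : cis (-(θ + Real.pi)) = -cis (-θ) := by
  have h : cis (-(θ + Real.pi)) * cis (Real.pi) = cis (-θ) := by
    rw [← cis_add]; congr 1; ring
  rw [cis_pi] at h
  rw [← h]; ring

theorem cis_inv (θ : ℝ) : (cis θ)⁻¹ = cis (-θ) := by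
  rw [inv_eq_iff_eq_inv, eq_comm]
  exact inv_eq_of_mul_eq_one_left (cis_mul_cis_neg θ)

theorem mem_cis_smul {θ : ℝ} {S : Set ℂ} {z : ℂ} : z ∈ cis θ • S ↔ cis (-θ) * z ∈ S := by
  rw [Set.mem_smul_set_iff_inv_smul_mem₀ (cis_ne_zero θ), cis_inv, smul_eq_mul]

theorem mem_upperHalf {θ : ℝ} {z : ℂ} : z ∈ upperHalf θ ↔ 0 ≤ (cis (-θ) * z).im := mem_cis_smul

theorem mem_thetaAxis {θ : ℝ} {z : ℂ} : z ∈ thetaAxis θ ↔ (cis (-θ) * z).im = 0 := mem_cis_smul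

theorem upperHalf_add_pi (θ : ℝ) : upperHalf (θ + Real.pi) = lowerHalf θ := by
  ext z
  rw [mem_upperHalf, lowerHalf, mem_cis_smul, cis_neg_add_pi, neg_mul, Complex.neg_im,
    Set.mem_ofPred_eq, neg_nonneg]

/-- Shifting `arg z` by 0 or ±π brings it into the half-open interval without changing the line
through 0. -/
theorem exists_angle (z : ℂ) :
    ∃ φ ∈ Set.Ico (-(Real.pi / 2)) (Real.pi / 2), (cis (-φ) * z).im = 0 := by
  have key : ∀ φ : ℝ, (cis (-φ) * z).im = ‖z‖ * Real.sin (z.arg - φ) := fun φ => by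
    have : cis (-φ) * z = (‖z‖ : ℂ) * cis (z.arg - φ) := by
      rw [sub_eq_add_neg, cis_add]
      conv_lhs => rw [← Complex.norm_mul_exp_arg_mul_I z]
      rw [cis, cis, mul_comm Complex.I (z.arg : ℂ)]
      ring
    rw [this, Complex.im_ofReal_mul, cis, mul_comm Complex.I, Complex.exp_ofReal_mul_I_im]
  have h1 := Complex.neg_pi_lt_arg z
  have h2 := Complex.arg_le_pi z
  have hp := Real.pi_pos
  rcases lt_or_ge z.arg (-(Real.pi / 2)) with h | h
  · exact ⟨z.arg + Real.pi, ⟨by linarith, by linarith⟩, by rw [key]; simp⟩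
  rcases lt_or_ge z.arg (Real.pi / 2) with h' | h'
  · exact ⟨z.arg, ⟨h, h'⟩, by simp [key]⟩
  · exact ⟨z.arg - Real.pi, ⟨by linarith, by linarith⟩, by rw [key]; simp⟩

end Cis

/-! ### The dictionary for matrices; invariances and spectrum -/

section MatrixFacts

variable {n : ℕ}

/-- The cosine undoes the arccosine and ignores the sign `s`, leaving modulus and real part.
Conversely, the sign of `Im z` dictates `s`. -/
theorem mem_srg_iff {B : Matrix (Fin n) (Fin n) ℂ} {z : ℂ} :
    z ∈ srg B ↔ parab z ∈ quadRange (Matrix.toEuclideanLin B) := by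
  rw [mem_quadRange_iff]
  constructor
  · rintro ⟨x, y, hy, hx, s, hs, rfl⟩
    change y = Matrix.toEuclideanLin B x at hy
    subst hy
    refine ⟨x, hx, ?_, ?_⟩
    · set y := Matrix.toEuclideanLin B x
      have hn : ‖x‖ ≠ 0 := norm_ne_zero_iff.2 hx
      have hcos : Real.cos (s * Real.arccos ((inner ℂ x y).re / (‖x‖ * ‖y‖))) =
          (inner ℂ x y).re / (‖x‖ * ‖y‖) := by
        have h1 := (Complex.abs_re_le_norm _).trans (norm_inner_le_norm (𝕜 := ℂ) x y)
        have h2 : |(inner ℂ x y).re / (‖x‖ * ‖y‖)| ≤ 1 := by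
          rw [abs_div, abs_of_nonneg (by positivity : (0 : ℝ) ≤ ‖x‖ * ‖y‖)]
          exact div_le_one_of_le₀ h1 (by positivity)
        rcases hs with rfl | rfl <;> simp [Real.cos_arccos (abs_le.1 h2).1 (abs_le.1 h2).2]
      simp only [parab]
      rw [Complex.re_ofReal_mul, mul_comm Complex.I, Complex.exp_ofReal_mul_I_re, hcos]
      rcases eq_or_ne ‖y‖ 0 with h0 | h0
      · simp [norm_eq_zero.1 h0]
      · field_simp
    · have hn : ‖x‖ ≠ 0 := norm_ne_zero_iff.2 hx
      simp only [parab]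
      rw [norm_mul, mul_comm Complex.I, Complex.norm_exp_ofReal_mul_I, mul_one, Complex.norm_real,
        Real.norm_eq_abs, sq_abs]
      field_simp
  · rintro ⟨x, hx, h1, h2⟩
    have hn : ‖x‖ ≠ 0 := norm_ne_zero_iff.2 hx
    refine ⟨x, Matrix.toEuclideanLin B x, rfl, hx, ?_⟩
    set y := Matrix.toEuclideanLin B x
    simp only [parab] at h1 h2
    have hy : ‖y‖ = ‖z‖ * ‖x‖ := by
      rw [← mul_pow] at h2
      exact (pow_left_inj₀ (norm_nonneg _) (by positivity) two_ne_zero).1 h2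
    have hq : ‖y‖ / ‖x‖ = ‖z‖ := by rw [hy]; field_simp
    rcases eq_or_ne z 0 with rfl | hz
    · exact ⟨1, Or.inl rfl, by rw [hq]; simp⟩
    have hzn : ‖z‖ ≠ 0 := norm_ne_zero_iff.2 hz
    have hr : (inner ℂ x y).re / (‖x‖ * ‖y‖) = z.re / ‖z‖ := by rw [h1, hy]; field_simp
    rw [hq, hr]
    rcases le_or_gt 0 z.im with him | him
    · refine ⟨1, Or.inl rfl, ?_⟩
      rw [one_mul, ← Complex.arg_of_im_nonneg_of_ne_zero him hz, mul_comm Complex.I,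
        Complex.norm_mul_exp_arg_mul_I]
    · refine ⟨-1, Or.inr rfl, ?_⟩
      rw [neg_one_mul, ← Complex.arg_of_im_neg him, mul_comm Complex.I,
        Complex.norm_mul_exp_arg_mul_I]

theorem mem_thetaSRG_iff {A : Matrix (Fin n) (Fin n) ℂ} {θ : ℝ} {z : ℂ} :
    z ∈ thetaSRG θ A ↔ parab (cis (-θ) * z) ∈ quadRange (Matrix.toEuclideanLin (cis (-θ) • A)) := by
  rw [thetaSRG, mem_cis_smul, mem_srg_iff]

theorem mem_eigs_iff {A : Matrix (Fin n) (Fin n) ℂ} {l : ℂ} :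
    l ∈ eigs A ↔ ∃ x : EuclideanSpace ℂ (Fin n), x ≠ 0 ∧ Matrix.toEuclideanLin A x = l • x := by
  constructor
  · intro h
    obtain ⟨v, hv⟩ := Module.End.HasEigenvalue.exists_hasEigenvector h
    refine ⟨WithLp.toLp 2 v, by simpa using hv.2, ?_⟩
    rw [Matrix.toLpLin_toLp, hv.apply_eq_smul]
    rfl
  · rintro ⟨x, hx, h⟩
    refine Module.End.hasEigenvalue_of_hasEigenvector (x := WithLp.ofLp x)
      ⟨Module.End.mem_eigenspace_iff.2 ?_, by simpa using hx⟩
    rw [← Matrix.ofLp_toLpLin 2 2, h]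
    rfl

theorem eigs_eq (A : Matrix (Fin n) (Fin n) ℂ) :
    eigs A = {l | Module.End.HasEigenvalue (Matrix.toEuclideanLin A) l} := by
  ext l
  rw [mem_eigs_iff]
  constructor
  · rintro ⟨x, hx, h⟩
    exact Module.End.hasEigenvalue_of_hasEigenvector ⟨Module.End.mem_eigenspace_iff.2 h, hx⟩
  · intro h
    obtain ⟨v, hv⟩ := Module.End.HasEigenvalue.exists_hasEigenvector h
    exact ⟨v, hv.2, hv.apply_eq_smul⟩

theorem mul_mem_eigs_smul_iff {A : Matrix (Fin n) (Fin n) ℂ} {c l : ℂ} (hc : c ≠ 0) :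
    c * l ∈ eigs (c • A) ↔ l ∈ eigs A := by
  simp only [mem_eigs_iff, map_smul, LinearMap.smul_apply, mul_smul, smul_right_inj hc]

theorem parab_mem_of_mem_eigs {A : Matrix (Fin n) (Fin n) ℂ} {l : ℂ} (hl : l ∈ eigs A) :
    parab l ∈ quadRange (Matrix.toEuclideanLin A) := by
  rw [eigs_eq] at hl
  exact parab_mem_quadRange_of_hasEigenvalue hl

theorem eigs_subset_thetaSRG (θ : ℝ) (A : Matrix (Fin n) (Fin n) ℂ) : eigs A ⊆ thetaSRG θ A :=
  fun _ hl => mem_thetaSRG_iff.2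
    (parab_mem_of_mem_eigs ((mul_mem_eigs_smul_iff (cis_ne_zero _)).2 hl))

theorem mem_eigs_of_mem_thetaSRG {A : Matrix (Fin n) (Fin n) ℂ} {θ : ℝ} {z : ℂ}
    (hz : (cis (-θ) * z).im = 0) (h : z ∈ thetaSRG θ A) : z ∈ eigs A :=
  (mul_mem_eigs_smul_iff (cis_ne_zero (-θ))).1
    (mem_eigs_iff.2 (hasEigenvalue_of_real hz (mem_thetaSRG_iff.1 h)))

theorem eigs_eq_iInter_thetaSRG (A : Matrix (Fin n) (Fin n) ℂ) :
    eigs A = ⋂ φ ∈ Set.Ico (-(Real.pi / 2)) (Real.pi / 2), thetaSRG φ A := by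
  refine Set.Subset.antisymm (Set.subset_iInter₂ fun φ _ => eigs_subset_thetaSRG φ A) ?_
  intro z hz
  obtain ⟨φ, hφ, h⟩ := exists_angle z
  exact mem_eigs_of_mem_thetaSRG h (Set.mem_iInter₂.1 hz φ hφ)

theorem thetaSRGUpper_inter_thetaAxis (θ : ℝ) (A : Matrix (Fin n) (Fin n) ℂ) :
    thetaSRGUpper θ A ∩ thetaAxis θ = eigs A ∩ thetaAxis θ := by
  ext z
  refine and_congr_left fun hz => ?_
  rw [mem_thetaAxis] at hz
  exact ⟨fun h => mem_eigs_of_mem_thetaSRG hz h.1,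
    fun h => ⟨eigs_subset_thetaSRG θ A h, mem_upperHalf.2 hz.ge⟩⟩

/-- A fixed point has nonnegative rotated imaginary part and `r = |z|²`, which is equality in
Cauchy-Schwarz. -/
theorem dwShell_fixed (θ : ℝ) (A : Matrix (Fin n) (Fin n) ℂ) :
    {p | p ∈ dwShell A ∧ thetaProj θ p = p} =
      (fun l : ℂ => (l, ‖l‖ ^ 2)) '' (eigs A ∩ upperHalf θ) := by
  have hfix : ∀ p : ℂ × ℝ, thetaProj θ p = p ↔
      (cis (-θ) * p.1).im = Real.sqrt (p.2 - (cis (-θ) * p.1).re ^ 2) := fun p => by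
    set w := cis (-θ) * p.1 with hw
    have h1 : p.1 = cis θ * w := by rw [hw, ← mul_assoc, cis_mul_cis_neg, one_mul]
    have h2 : thetaProj θ p = p ↔ (projParab (w, p.2)).1 = w := by
      rw [Prod.ext_iff, h1]
      simp only [thetaProj, projParab, and_true]
      rw [← hw]
      exact mul_right_inj' (cis_ne_zero θ)
    rw [h2, Complex.ext_iff]
    simp [projParab, eq_comm]
  have hns : ∀ z : ℂ, z.re ^ 2 + z.im ^ 2 = ‖z‖ ^ 2 := fun z => by
    rw [← Complex.normSq_eq_norm_sq, Complex.normSq_apply]; ring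
  have hnw : ∀ z : ℂ, ‖cis (-θ) * z‖ = ‖z‖ := fun z => by rw [norm_mul, norm_cis, one_mul]
  ext p
  constructor
  · rintro ⟨⟨x, y, hy, hx, rfl⟩, hp⟩
    have hn : ‖x‖ ≠ 0 := norm_ne_zero_iff.2 hx
    rw [hfix] at hp
    set l := inner ℂ x y / ((‖x‖ ^ 2 : ℝ) : ℂ) with hl
    have hlx : inner ℂ x y = l * ((‖x‖ ^ 2 : ℝ) : ℂ) := by
      rw [hl, div_mul_cancel₀]
      exact_mod_cast pow_ne_zero 2 hn
    -- Needed because `Real.sqrt` is 0 on negative numbers; this keeps the radicand nonnegative.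
    have hle : ‖l‖ ^ 2 ≤ ‖y‖ ^ 2 / ‖x‖ ^ 2 := by
      have h1 := norm_inner_le_norm (𝕜 := ℂ) x y
      rw [hlx, norm_mul, Complex.norm_real, Real.norm_of_nonneg (by positivity)] at h1
      rw [← div_pow]
      gcongr
      rw [le_div_iff₀ (by positivity)]
      refine le_of_mul_le_mul_right ?_ (by positivity : 0 < ‖x‖)
      linarith
    simp only at hp
    have him : 0 ≤ (cis (-θ) * l).im := hp ▸ Real.sqrt_nonneg _
    have heq : ‖y‖ ^ 2 / ‖x‖ ^ 2 = ‖l‖ ^ 2 := by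
      have h1 := hns (cis (-θ) * l)
      rw [hnw] at h1
      have h2 : 0 ≤ ‖y‖ ^ 2 / ‖x‖ ^ 2 - (cis (-θ) * l).re ^ 2 := by
        nlinarith [sq_nonneg (cis (-θ) * l).im]
      rw [hp, Real.sq_sqrt h2] at h1
      linarith
    refine ⟨l, ⟨mem_eigs_iff.2 ⟨x, hx, ?_⟩, mem_upperHalf.2 him⟩, by rw [heq]⟩
    change y = _ at hy
    rw [← hy]
    refine eq_smul_of_norm_eq ?_ ?_
    · rw [hlx, ← mul_assoc, mul_comm (conj l), Complex.mul_conj, ← Complex.ofReal_mul,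
        Complex.ofReal_re, Complex.normSq_eq_norm_sq]
    · rw [← heq]; field_simp
  · rintro ⟨l, ⟨hl, hu⟩, rfl⟩
    obtain ⟨x, hx, h⟩ := mem_eigs_iff.1 hl
    have hn : ‖x‖ ≠ 0 := norm_ne_zero_iff.2 hx
    refine ⟨⟨x, l • x, h.symm, hx, ?_⟩, ?_⟩
    · rw [inner_smul_right, inner_self_eq_norm_sq_to_K, norm_smul, mul_pow, mul_div_assoc]
      have : (‖x‖ : ℂ) ≠ 0 := by exact_mod_cast hn
      ext
      · simp; field_simp
      · simp; field_simp
    · rw [hfix]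
      simp only
      rw [← hnw, ← hns, add_sub_cancel_left, Real.sqrt_sq (mem_upperHalf.1 hu)]

theorem thetaSRG_add_pi (θ : ℝ) (A : Matrix (Fin n) (Fin n) ℂ) :
    thetaSRG θ A = thetaSRG (θ + Real.pi) A := by
  ext z
  rw [mem_thetaSRG_iff, mem_thetaSRG_iff, cis_neg_add_pi,
    ← parab_real_mul_mem_iff (neg_ne_zero.2 one_ne_zero : (-1 : ℝ) ≠ 0)]
  simp

theorem quadRange_conjTranspose (B : Matrix (Fin n) (Fin n) ℂ) :
    quadRange (Matrix.toEuclideanLin Bᴴ) = quadRange (Matrix.toEuclideanLin B) := by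
  rw [Matrix.toEuclideanLin_conjTranspose_eq_adjoint, quadRange_adjoint]

/-- Entrywise conjugation `c` is antiunitary and intertwines `Cᵀ` with `Cᴴ`, which reduces the
transpose to the adjoint. -/
theorem quadRange_transpose (B : Matrix (Fin n) (Fin n) ℂ) :
    quadRange (Matrix.toEuclideanLin Bᵀ) = quadRange (Matrix.toEuclideanLin B) := by
  let c : EuclideanSpace ℂ (Fin n) → EuclideanSpace ℂ (Fin n) :=
    fun x => WithLp.toLp 2 (star (WithLp.ofLp x))
  have hcc : ∀ x, c (c x) = x := fun x => by simp [c]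
  have hcn : ∀ x, ‖c x‖ = ‖x‖ := fun x => by simp [c, EuclideanSpace.norm_eq]
  have hci : ∀ x y, inner ℂ (c x) (c y) = conj (inner ℂ x y) := fun x y => by
    simp [c, PiLp.inner_apply, mul_comm]
  have hcB : ∀ (C : Matrix (Fin n) (Fin n) ℂ) x,
      Matrix.toEuclideanLin Cᵀ (c x) = c (Matrix.toEuclideanLin Cᴴ x) := fun C x => by
    ext i
    simp [c, Matrix.toLpLin_apply, Matrix.mulVec, dotProduct]
  have key : ∀ C : Matrix (Fin n) (Fin n) ℂ,
      quadRange (Matrix.toEuclideanLin Cᴴ) ⊆ quadRange (Matrix.toEuclideanLin Cᵀ) := by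
    rintro C _ ⟨x, hx, rfl⟩
    refine ⟨c x, by simpa [hcn] using hx, ?_⟩
    simp only [hcB, hci, hcn, Complex.conj_re]
  refine Set.Subset.antisymm ?_ ((quadRange_conjTranspose B).symm.subset.trans (key B))
  have h := key Bᵀ
  rwa [Matrix.transpose_transpose, quadRange_conjTranspose] at h

theorem toEuclideanLin_mul_apply (B C : Matrix (Fin n) (Fin n) ℂ) (x : EuclideanSpace ℂ (Fin n)) :
    Matrix.toEuclideanLin (B * C) x = Matrix.toEuclideanLin B (Matrix.toEuclideanLin C x) := by
  simp [Matrix.toLpLin_apply]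

theorem quadRange_unitary_subset (B : Matrix (Fin n) (Fin n) ℂ) {U : Matrix (Fin n) (Fin n) ℂ}
    (hU : U ∈ Matrix.unitaryGroup (Fin n) ℂ) :
    quadRange (Matrix.toEuclideanLin (Uᴴ * B * U)) ⊆ quadRange (Matrix.toEuclideanLin B) := by
  have hiso : ∀ V : Matrix (Fin n) (Fin n) ℂ, Vᴴ * V = 1 → ∀ x,
      ‖Matrix.toEuclideanLin V x‖ = ‖x‖ := fun V hV x => by
    have h : inner ℂ (Matrix.toEuclideanLin V x) (Matrix.toEuclideanLin V x) = inner ℂ x x := by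
      rw [← LinearMap.adjoint_inner_right, ← Matrix.toEuclideanLin_conjTranspose_eq_adjoint,
        ← toEuclideanLin_mul_apply, hV]
      simp
    rw [inner_self_eq_norm_sq_to_K, inner_self_eq_norm_sq_to_K] at h
    have h' : ‖Matrix.toEuclideanLin V x‖ ^ 2 = ‖x‖ ^ 2 := by exact_mod_cast h
    exact (pow_left_inj₀ (norm_nonneg _) (norm_nonneg _) two_ne_zero).1 h'
  rintro _ ⟨x, hx, rfl⟩
  refine ⟨Matrix.toEuclideanLin U x, ?_, ?_⟩
  · rw [mem_sphere_zero_iff_norm, hiso U (Matrix.mem_unitaryGroup_iff'.1 hU)]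
    simpa using hx
  · simp only [mul_assoc, toEuclideanLin_mul_apply Uᴴ]
    rw [hiso Uᴴ (by rw [Matrix.conjTranspose_conjTranspose]; exact Matrix.mem_unitaryGroup_iff.1 hU), toEuclideanLin_mul_apply B,
      Matrix.toEuclideanLin_conjTranspose_eq_adjoint, LinearMap.adjoint_inner_right]

theorem quadRange_unitary (B : Matrix (Fin n) (Fin n) ℂ) {U : Matrix (Fin n) (Fin n) ℂ}
    (hU : U ∈ Matrix.unitaryGroup (Fin n) ℂ) :
    quadRange (Matrix.toEuclideanLin (Uᴴ * B * U)) = quadRange (Matrix.toEuclideanLin B) := by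
  refine (quadRange_unitary_subset B hU).antisymm ?_
  have h := quadRange_unitary_subset (Uᴴ * B * U) (U := Uᴴ) (Unitary.star_mem hU)
  have h1 : U * Uᴴ = 1 := Matrix.mem_unitaryGroup_iff.1 hU
  have h2 : Uᴴᴴ * (Uᴴ * B * U) * Uᴴ = B := by
    rw [Matrix.conjTranspose_conjTranspose, ← mul_assoc, ← mul_assoc, h1, one_mul, mul_assoc, h1,
      mul_one]
  rwa [h2] at h

theorem thetaSRG_transpose (θ : ℝ) (A : Matrix (Fin n) (Fin n) ℂ) :
    thetaSRG θ A = thetaSRG θ Aᵀ := by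
  ext z
  rw [mem_thetaSRG_iff, mem_thetaSRG_iff, ← Matrix.transpose_smul, quadRange_transpose]

theorem thetaSRG_conjTranspose (θ : ℝ) (A : Matrix (Fin n) (Fin n) ℂ) :
    thetaSRG θ A = (fun z : ℂ => conj z) '' thetaSRG (-θ) Aᴴ := by
  ext z
  have h1 : z ∈ (fun z : ℂ => conj z) '' thetaSRG (-θ) Aᴴ ↔ conj z ∈ thetaSRG (-θ) Aᴴ :=
    ⟨by rintro ⟨w, hw, rfl⟩; simpa using hw, fun h => ⟨_, h, by simp⟩⟩
  have h2 : cis (- -θ) • Aᴴ = (cis (-θ) • A)ᴴ := by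
    rw [Matrix.conjTranspose_smul, ← conj_cis (-θ)]; rfl
  rw [h1, mem_thetaSRG_iff, mem_thetaSRG_iff, h2, quadRange_conjTranspose, ← conj_cis (-θ),
    ← map_mul, parab_conj]

theorem thetaSRG_cis_smul (θ α : ℝ) (A : Matrix (Fin n) (Fin n) ℂ) :
    thetaSRG θ (cis α • A) = cis α • thetaSRG (θ - α) A := by
  ext z
  have h1 : cis (-θ) * cis α = cis (-(θ - α)) := by rw [← cis_add]; congr 1; ring
  have h2 : cis (-(θ - α)) * cis (-α) = cis (-θ) := by rw [← cis_add]; congr 1; ring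
  rw [mem_cis_smul, mem_thetaSRG_iff, mem_thetaSRG_iff, smul_smul, h1, ← mul_assoc, h2]

theorem quadRange_nonempty (hn : 0 < n) (A : Matrix (Fin n) (Fin n) ℂ) :
    (quadRange (Matrix.toEuclideanLin A)).Nonempty := by
  have : Nonempty (Fin n) := ⟨⟨0, hn⟩⟩
  exact (NormedSpace.sphere_nonempty.2 zero_le_one).image _

theorem exists_parab_mem {A : Matrix (Fin n) (Fin n) ℂ} {p : ℝ × ℝ}
    (hp : p ∈ quadRange (Matrix.toEuclideanLin A)) :
    ∃ z : ℂ, 0 ≤ z.im ∧ parab z = p := by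
  refine ⟨⟨p.1, Real.sqrt (p.2 - p.1 ^ 2)⟩, Real.sqrt_nonneg _, ?_⟩
  ext
  · rfl
  · rw [parab, ← Complex.normSq_eq_norm_sq, Complex.normSq_apply]
    simp only
    rw [Real.mul_self_sqrt (sub_nonneg.2 (sq_le_of_mem_quadRange hp))]
    ring

theorem thetaSRG_real_smul (hn : 0 < n) (θ γ : ℝ) (A : Matrix (Fin n) (Fin n) ℂ) :
    thetaSRG θ ((γ : ℂ) • A) = (γ : ℂ) • thetaSRG θ A := by
  -- For `γ = 0` both sides are `{0}`, which requires `n > 0`: otherwise both sets would be empty.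
  rcases eq_or_ne γ 0 with rfl | hγ
  · have hne : (thetaSRG θ A).Nonempty := by
      obtain ⟨p, hp⟩ := quadRange_nonempty hn (cis (-θ) • A)
      obtain ⟨z, -, rfl⟩ := exists_parab_mem hp
      exact ⟨cis θ * z, mem_thetaSRG_iff.2 (by rwa [← mul_assoc, cis_neg_mul_cis, one_mul])⟩
    rw [Complex.ofReal_zero, Set.zero_smul_set hne, zero_smul]
    ext z
    rw [mem_thetaSRG_iff, smul_zero, map_zero, Set.mem_zero]
    constructor
    · intro h
      obtain ⟨x, hx, -, h⟩ := mem_quadRange_iff.1 h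
      simpa [parab, hx, cis_ne_zero] using h
    · rintro rfl
      obtain ⟨_, x, hx, -⟩ := quadRange_nonempty hn A
      exact ⟨x, hx, by simp [parab]⟩
  · ext z
    have hγ' : (γ : ℂ) ≠ 0 := by exact_mod_cast hγ
    rw [Set.mem_smul_set_iff_inv_smul_mem₀ hγ', mem_thetaSRG_iff, mem_thetaSRG_iff, smul_eq_mul,
      ← parab_real_mul_mem_iff hγ (z := cis (-θ) * ((γ : ℂ)⁻¹ * z)), smul_comm,
      map_smul _ (γ : ℂ), mul_left_comm (γ : ℂ), mul_inv_cancel_left₀ hγ']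

theorem thetaSRG_unitary (θ : ℝ) (A : Matrix (Fin n) (Fin n) ℂ) {U : Matrix (Fin n) (Fin n) ℂ}
    (hU : U ∈ Matrix.unitaryGroup (Fin n) ℂ) : thetaSRG θ (Uᴴ * A * U) = thetaSRG θ A := by
  ext z
  rw [mem_thetaSRG_iff, mem_thetaSRG_iff, ← quadRange_unitary (cis (-θ) • A) hU]
  simp

end MatrixFacts

end ThetaSRG

namespace ThetaSRG

/-! ### Transport between the upper half plane and the parabolic region -/

section UpperPreimage

/-- The points of the closed upper half plane represented in `W`. -/
def upperPreimage (W : Set (ℝ × ℝ)) : Set ℂ := {z | 0 ≤ z.im ∧ parab z ∈ W}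

/-- The point of the closed upper half plane represented by `p`, if `p.1 ^ 2 ≤ p.2`. -/
noncomputable def unparab (p : ℝ × ℝ) : ℂ := ⟨p.1, Real.sqrt (p.2 - p.1 ^ 2)⟩

theorem parab_snd (z : ℂ) : (parab z).2 = z.re ^ 2 + z.im ^ 2 := by
  rw [parab, ← Complex.normSq_eq_norm_sq, Complex.normSq_apply]; ring

theorem parab_fst (z : ℂ) : (parab z).1 = z.re := rfl

theorem parab_unparab {p : ℝ × ℝ} (hp : p.1 ^ 2 ≤ p.2) : parab (unparab p) = p := by
  ext
  · rfl
  · rw [parab_snd, unparab]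
    simp only
    rw [Real.sq_sqrt (sub_nonneg.2 hp)]
    ring

theorem unparab_parab {z : ℂ} (hz : 0 ≤ z.im) : unparab (parab z) = z := by
  refine Complex.ext rfl ?_
  rw [unparab, parab_snd, parab_fst, add_sub_cancel_left, Real.sqrt_sq hz]

theorem unparab_im_nonneg (p : ℝ × ℝ) : 0 ≤ (unparab p).im := Real.sqrt_nonneg _

theorem continuous_parab : Continuous parab := by
  unfold parab; fun_prop

theorem continuous_unparab : Continuous unparab :=
  Complex.equivRealProdCLM.symm.continuous.comp
    (f := fun p : ℝ × ℝ => (p.1, Real.sqrt (p.2 - p.1 ^ 2))) (by fun_prop)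

variable {W : Set (ℝ × ℝ)}

/-- A planar set inside `{(t, r) | t ^ 2 ≤ r}` is homeomorphic to the set that it represents. -/
noncomputable def upperPreimageHomeomorph (hW : ∀ p ∈ W, p.1 ^ 2 ≤ p.2) : W ≃ₜ upperPreimage W where
  toFun p := ⟨unparab p, unparab_im_nonneg _, (parab_unparab (hW p p.2)).symm ▸ p.2⟩
  invFun z := ⟨parab z, z.2.2⟩
  left_inv p := Subtype.ext (parab_unparab (hW p p.2))
  right_inv z := Subtype.ext (unparab_parab z.2.1)
  continuous_toFun := (continuous_unparab.comp continuous_subtype_val).subtype_mk _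
  continuous_invFun := (continuous_parab.comp continuous_subtype_val).subtype_mk _

theorem isSimplyConnected_upperPreimage (hW : ∀ p ∈ W, p.1 ^ 2 ≤ p.2) (hc : Convex ℝ W)
    (hne : W.Nonempty) : IsSimplyConnected (upperPreimage W) := by
  have : ContractibleSpace W := hc.contractibleSpace hne
  have : ContractibleSpace (upperPreimage W) := (upperPreimageHomeomorph hW).symm.contractibleSpace
  exact SimplyConnectedSpace.ofContractible _

theorem isClosed_upperPreimage (hcl : IsClosed W) : IsClosed (upperPreimage W) :=
  (isClosed_le continuous_const Complex.continuous_im).inter (hcl.preimage continuous_parab)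

/-- Off the real axis `parab` is a local homeomorphism. On it, the point is interior neither to the
half plane nor, after `parab`, to the parabolic region. -/
theorem mem_frontier_upperPreimage (hW : ∀ p ∈ W, p.1 ^ 2 ≤ p.2) (hcl : IsClosed W) {z : ℂ} :
    z ∈ frontier (upperPreimage W) ↔ 0 ≤ z.im ∧ parab z ∈ frontier W := by
  rw [(isClosed_upperPreimage hcl).frontier_eq, hcl.frontier_eq]
  suffices h : 0 ≤ z.im → (z ∈ interior (upperPreimage W) ↔ parab z ∈ interior W) by
    constructor
    · rintro ⟨⟨h1, h2⟩, h3⟩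
      exact ⟨h1, h2, fun h4 => h3 ((h h1).2 h4)⟩
    · rintro ⟨h1, h2, h3⟩
      exact ⟨⟨h1, h2⟩, fun h4 => h3 ((h h1).1 h4)⟩
  intro hz
  rw [mem_interior_iff_mem_nhds, mem_interior_iff_mem_nhds]
  constructor
  · intro h
    have hpos : 0 < z.im := by
      have h1 : z ∈ interior {w : ℂ | 0 ≤ w.im} :=
        mem_interior_iff_mem_nhds.2 (Filter.mem_of_superset h fun w hw => hw.1)
      rwa [Complex.interior_setOfPred_le_im] at h1
    have h1 : unparab ⁻¹' upperPreimage W ∈ nhds (parab z) :=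
      continuous_unparab.continuousAt.preimage_mem_nhds (by rwa [unparab_parab hz])
    have h2 : {p : ℝ × ℝ | p.1 ^ 2 < p.2} ∈ nhds (parab z) := by
      refine (isOpen_lt (by fun_prop) (by fun_prop)).mem_nhds ?_
      change (parab z).1 ^ 2 < (parab z).2
      rw [parab_snd, parab_fst]
      have := pow_pos hpos 2
      linarith
    filter_upwards [h1, h2] with p hp1 hp2
    have := hp1.2
    rwa [parab_unparab (le_of_lt hp2)] at this
  · intro h
    have hpos : 0 < z.im := by
      refine lt_of_le_of_ne hz fun h0 => ?_
      -- The tangent to the parabola at `parab z` supports the whole region.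
      refine notMem_interior_of_support (W := {p : ℝ × ℝ | p.1 ^ 2 ≤ p.2}) (x := parab z)
        (a := 2 * z.re) (b := -1) (by positivity) ?_
        (mem_interior_iff_mem_nhds.2 (Filter.mem_of_superset h hW))
      intro p hp
      have hp : p.1 ^ 2 ≤ p.2 := hp
      rw [parab_snd, parab_fst, ← h0]
      nlinarith [sq_nonneg (p.1 - z.re)]
    filter_upwards [continuous_parab.continuousAt.preimage_mem_nhds h,
      (isOpen_lt continuous_const Complex.continuous_im).mem_nhds hpos] with w h1 h2
    exact ⟨le_of_lt h2, h1⟩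

end UpperPreimage

/-! ### Arcs as segments -/

section Arcs

theorem mem_segment_vertical {a b p : ℝ × ℝ} (hab : a.1 = b.1) :
    p ∈ segment ℝ a b ↔ p.1 = a.1 ∧ p.2 ∈ Set.uIcc a.2 b.2 := by
  rw [← segment_eq_uIcc]
  constructor
  · rintro ⟨s, t, hs, ht, hst, rfl⟩
    refine ⟨?_, s, t, hs, ht, hst, rfl⟩
    simp only [Prod.fst_add, Prod.smul_fst, smul_eq_mul, ← hab]
    linear_combination a.1 * hst
  · rintro ⟨h, s, t, hs, ht, hst, h'⟩
    refine ⟨s, t, hs, ht, hst, Prod.ext ?_ h'⟩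
    simp only [Prod.fst_add, Prod.smul_fst, smul_eq_mul, ← hab, h]
    linear_combination a.1 * hst

theorem mem_segment_slanted {a b p : ℝ × ℝ} (hab : a.1 ≠ b.1) :
    p ∈ segment ℝ a b ↔
      p.1 ∈ Set.uIcc a.1 b.1 ∧ (p.2 - a.2) * (b.1 - a.1) = (p.1 - a.1) * (b.2 - a.2) := by
  rw [← segment_eq_uIcc]
  constructor
  · rintro ⟨s, t, hs, ht, hst, rfl⟩
    refine ⟨⟨s, t, hs, ht, hst, rfl⟩, ?_⟩
    simp only [Prod.fst_add, Prod.smul_fst, Prod.snd_add, Prod.smul_snd, smul_eq_mul]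
    linear_combination (a.2 * (b.1 - a.1) - a.1 * (b.2 - a.2)) * hst
  · rintro ⟨⟨s, t, hs, ht, hst, h⟩, h'⟩
    refine ⟨s, t, hs, ht, hst, Prod.ext h ?_⟩
    simp only [smul_eq_mul] at h
    simp only [Prod.snd_add, Prod.smul_snd, smul_eq_mul]
    refine mul_right_cancel₀ (sub_ne_zero.2 hab.symm) ?_
    rw [← h] at h'
    linear_combination (a.2 * (b.1 - a.1) - a.1 * (b.2 - a.2)) * hst - h'

theorem mem_segment_of_re_eq {a b w : ℂ} (hab : a.re = b.re) :
    w ∈ segment ℝ a b ↔ w.re = a.re ∧ w.im ∈ Set.uIcc a.im b.im := by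
  have h := mem_segment_vertical (a := (a.re, a.im)) (b := (b.re, b.im)) (p := (w.re, w.im)) hab
  rw [← h]
  constructor
  · rintro ⟨s, t, hs, ht, hst, rfl⟩
    exact ⟨s, t, hs, ht, hst, by simp⟩
  · rintro ⟨s, t, hs, ht, hst, h'⟩
    refine ⟨s, t, hs, ht, hst, ?_⟩
    simp only [Prod.ext_iff] at h'
    exact Complex.ext (by simpa using h'.1) (by simpa using h'.2)

theorem sq_mem_uIcc_iff {x a b t : ℝ} (hx : 0 ≤ x) (ha : 0 ≤ a) (hb : 0 ≤ b) :
    t + x ^ 2 ∈ Set.uIcc (t + a ^ 2) (t + b ^ 2) ↔ x ∈ Set.uIcc a b := by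
  simp only [Set.mem_uIcc, add_le_add_iff_left, pow_le_pow_iff_left₀ ha hx two_ne_zero,
    pow_le_pow_iff_left₀ hb hx two_ne_zero, pow_le_pow_iff_left₀ hx ha two_ne_zero,
    pow_le_pow_iff_left₀ hx hb two_ne_zero]

/-- The right-hand side is affine in `parab z`: this is why circles centered on the real axis become
lines. -/
theorem norm_sub_real_sq (z : ℂ) (c : ℝ) :
    ‖z - c‖ ^ 2 = (parab z).2 - 2 * c * (parab z).1 + c ^ 2 := by
  rw [parab_snd, parab_fst, ← Complex.normSq_eq_norm_sq, Complex.normSq_apply]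
  simp
  ring

/-- Segments of the parabolic region represent the minor arcs centered on the real axis. -/
theorem parab_mem_segment_iff {a b w : ℂ} (ha : 0 ≤ a.im) (hb : 0 ≤ b.im) :
    (0 ≤ w.im ∧ parab w ∈ segment ℝ (parab a) (parab b)) ↔
      (a.re = b.re ∧ w ∈ segment ℝ a b) ∨
      (a.re ≠ b.re ∧ 0 ≤ w.im ∧ w.re ∈ Set.uIcc a.re b.re ∧
        ∃ c : ℝ, ‖a - c‖ = ‖b - c‖ ∧ ‖w - c‖ = ‖a - c‖) := by
  rcases eq_or_ne a.re b.re with h | h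
  · simp only [h, true_and, ne_eq, not_true_eq_false, false_and, or_false]
    rw [mem_segment_of_re_eq h, mem_segment_vertical (by exact h)]
    simp only [parab_snd, parab_fst, h]
    constructor
    · rintro ⟨h1, h2, h3⟩
      rw [h2] at h3
      exact ⟨h2, (sq_mem_uIcc_iff h1 ha hb).1 h3⟩
    · rintro ⟨h2, h3⟩
      have h1 : 0 ≤ w.im := (le_min ha hb).trans h3.1
      rw [h2]
      exact ⟨h1, rfl, (sq_mem_uIcc_iff h1 ha hb).2 h3⟩
  · simp only [h, false_and, ne_eq, not_false_eq_true, true_and, false_or]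
    rw [mem_segment_slanted (by exact h)]
    have hsq : ∀ u v : ℂ, ∀ c : ℝ, ‖u - c‖ = ‖v - c‖ ↔
        (parab u).2 - 2 * c * u.re = (parab v).2 - 2 * c * v.re := fun u v c => by
      rw [← pow_left_inj₀ (norm_nonneg _) (norm_nonneg _) two_ne_zero, norm_sub_real_sq,
        norm_sub_real_sq, add_left_inj, parab_fst, parab_fst]
    simp only [hsq, parab_fst]
    refine and_congr_right fun _ => and_congr_right fun _ => ⟨fun h1 => ?_, ?_⟩
    · have h0 : b.re - a.re ≠ 0 := sub_ne_zero.2 h.symm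
      -- The chord from `parab a` to `parab b` has slope `2 * c`.
      refine ⟨((parab b).2 - (parab a).2) / (2 * (b.re - a.re)), ?_, ?_⟩
      · field_simp
        ring
      · have h2 : (parab w).2 = (parab a).2 +
            (w.re - a.re) * ((parab b).2 - (parab a).2) / (b.re - a.re) := by
          field_simp
          linear_combination h1
        rw [h2]
        field_simp
        ring
    · rintro ⟨c, h1, h2⟩
      linear_combination (b.re - a.re) * h2 + (w.re - a.re) * h1

theorem mem_thetaArc_iff {θ : ℝ} {z₁ z₂ w : ℂ} (h₁ : z₁ ∈ upperHalf θ) (h₂ : z₂ ∈ upperHalf θ) :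
    w ∈ thetaArc θ z₁ z₂ ↔
      w ∈ upperHalf θ ∧
        parab (cis (-θ) * w) ∈ segment ℝ (parab (cis (-θ) * z₁)) (parab (cis (-θ) * z₂)) := by
  have hseg : w ∈ segment ℝ z₁ z₂ ↔
      cis (-θ) * w ∈ segment ℝ (cis (-θ) * z₁) (cis (-θ) * z₂) := by
    have h := image_segment ℝ (LinearMap.mulLeft ℝ (cis (-θ))).toAffineMap z₁ z₂
    simp only [LinearMap.coe_toAffineMap, LinearMap.mulLeft_apply] at h
    rw [← h]
    exact ((mul_right_injective₀ (cis_ne_zero (-θ))).mem_set_image).symm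
  have hnorm : ∀ (z : ℂ) (c : ℝ), ‖z - c * cis θ‖ = ‖cis (-θ) * z - c‖ := fun z c => by
    rw [← one_mul ‖z - _‖, ← norm_cis (-θ), ← norm_mul, mul_sub, mul_left_comm, cis_neg_mul_cis,
      mul_one]
  rw [mem_upperHalf] at h₁ h₂
  rw [mem_upperHalf, parab_mem_segment_iff h₁ h₂, ← hseg]
  simp only [thetaArc, axisCoord, hnorm, mem_upperHalf, Set.mem_ofPred_eq]

end Arcs

/-! ### Topology of the upper part and its boundary for normal matrices -/

section Main

variable {n : ℕ}

theorem thetaSRGUpper_eq_preimage (θ : ℝ) (A : Matrix (Fin n) (Fin n) ℂ) :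
    thetaSRGUpper θ A = Homeomorph.mulLeft₀ (cis (-θ)) (cis_ne_zero (-θ)) ⁻¹'
      upperPreimage (quadRange (Matrix.toEuclideanLin (cis (-θ) • A))) := by
  ext z
  rw [thetaSRGUpper, Set.mem_inter_iff, mem_thetaSRG_iff, mem_upperHalf, and_comm]
  rfl

theorem mem_thetaSRGUpper_iff {θ : ℝ} {A : Matrix (Fin n) (Fin n) ℂ} {z : ℂ} :
    z ∈ thetaSRGUpper θ A ↔ z ∈ upperHalf θ ∧
      parab (cis (-θ) * z) ∈ quadRange (Matrix.toEuclideanLin (cis (-θ) • A)) := by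
  rw [thetaSRGUpper, Set.mem_inter_iff, mem_thetaSRG_iff, and_comm]

theorem isSimplyConnected_thetaSRGUpper (hn : 0 < n) (θ : ℝ) (A : Matrix (Fin n) (Fin n) ℂ) :
    IsSimplyConnected (thetaSRGUpper θ A) := by
  rw [thetaSRGUpper_eq_preimage, Homeomorph.isSimplyConnected_preimage]
  exact isSimplyConnected_upperPreimage (fun p hp => sq_le_of_mem_quadRange hp)
    (convex_quadRange _) (quadRange_nonempty hn _)

theorem thetaArc_subset_thetaSRGUpper {θ : ℝ} {A : Matrix (Fin n) (Fin n) ℂ} {z₁ z₂ : ℂ}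
    (h₁ : z₁ ∈ thetaSRGUpper θ A) (h₂ : z₂ ∈ thetaSRGUpper θ A) :
    thetaArc θ z₁ z₂ ⊆ thetaSRGUpper θ A := by
  intro w hw
  rw [mem_thetaSRGUpper_iff] at h₁ h₂ ⊢
  rw [mem_thetaArc_iff h₁.1 h₂.1] at hw
  exact ⟨hw.1, (convex_quadRange _).segment_subset h₁.2 h₂.2 hw.2⟩

theorem mem_frontier_thetaSRGUpper {θ : ℝ} {A : Matrix (Fin n) (Fin n) ℂ} {z : ℂ} :
    z ∈ frontier (thetaSRGUpper θ A) ↔ z ∈ upperHalf θ ∧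
      parab (cis (-θ) * z) ∈
        frontier (quadRange (Matrix.toEuclideanLin (cis (-θ) • A))) := by
  rw [thetaSRGUpper_eq_preimage, ← Homeomorph.preimage_frontier, Set.mem_preimage,
    mem_frontier_upperPreimage (fun p hp => sq_le_of_mem_quadRange hp)
      (isCompact_quadRange _).isClosed, mem_upperHalf]
  rfl

/-- `parab` does not distinguish conjugates, so folding across the axis is invisible to it. -/
theorem image_parab_foldedEigs (θ : ℝ) (A : Matrix (Fin n) (Fin n) ℂ) :
    (fun z => parab (cis (-θ) * z)) '' foldedEigs θ A = parab '' eigs (cis (-θ) • A) := by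
  have hrefl : ∀ z, cis (-θ) * axisReflect θ z = conj (cis (-θ) * z) := fun z => by
    rw [axisReflect, ← mul_assoc, cis_neg_mul_cis, one_mul]
  have hmem : ∀ z, z ∈ eigs A ↔ cis (-θ) * z ∈ eigs (cis (-θ) • A) :=
    fun z => (mul_mem_eigs_smul_iff (cis_ne_zero (-θ))).symm
  ext p
  constructor
  · rintro ⟨z, ⟨-, h | h⟩, rfl⟩
    · exact ⟨_, (hmem z).1 h, rfl⟩
    · rw [hmem, hrefl] at h
      exact ⟨_, h, parab_conj _⟩
  · rintro ⟨l, hl, rfl⟩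
    have hinv : ∀ w, cis (-θ) * (cis θ * w) = w := fun w => by
      rw [← mul_assoc, cis_neg_mul_cis, one_mul]
    rcases le_total 0 l.im with h | h
    · refine ⟨cis θ * l, ⟨mem_upperHalf.2 (by rwa [hinv]), Or.inl ?_⟩, by simp only [hinv]⟩
      rwa [hmem, hinv]
    · refine ⟨cis θ * conj l, ⟨mem_upperHalf.2 (by rw [hinv]; simpa using h), Or.inr ?_⟩, ?_⟩
      · rwa [hmem, hrefl, hinv, Complex.conj_conj]
      · simp only [hinv, parab_conj]

theorem quadRange_eq_convexHull_foldedEigs (θ : ℝ) {A : Matrix (Fin n) (Fin n) ℂ}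
    (hA : IsStarNormal A) :
    quadRange (Matrix.toEuclideanLin (cis (-θ) • A)) =
      convexHull ℝ ((fun z => parab (cis (-θ) * z)) '' foldedEigs θ A) := by
  rw [image_parab_foldedEigs, eigs_eq, quadRange_eq_convexHull]
  rw [← Matrix.toEuclideanLin_conjTranspose_eq_adjoint]
  have h : (cis (-θ) • A)ᴴ * (cis (-θ) • A) = (cis (-θ) • A) * (cis (-θ) • A)ᴴ := by
    have h1 : Aᴴ * A = A * Aᴴ := hA.star_comm_self
    rw [Matrix.conjTranspose_smul, smul_mul_smul_comm, smul_mul_smul_comm, h1, mul_comm (star _)]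
  refine LinearMap.ext fun x => ?_
  rw [Module.End.mul_apply, Module.End.mul_apply, ← toEuclideanLin_mul_apply,
    ← toEuclideanLin_mul_apply, h]

theorem parab_cis_injOn (θ : ℝ) : Set.InjOn (fun z => parab (cis (-θ) * z)) (upperHalf θ) :=
  fun _ hz _ hw h => mul_right_injective₀ (cis_ne_zero (-θ))
    (parab_injOn (mem_upperHalf.1 hz) (mem_upperHalf.1 hw) h)

theorem frontier_thetaSRGUpper_of_nontrivial {θ : ℝ} {A : Matrix (Fin n) (Fin n) ℂ}
    (hA : IsStarNormal A) (hE : (foldedEigs θ A).Nontrivial) :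
    ∃ P : Set (ℂ × ℂ), P ⊆ (foldedEigs θ A).offDiag ∧
      frontier (thetaSRGUpper θ A) = ⋃ p ∈ P, thetaArc θ p.1 p.2 := by
  set f : ℂ → ℝ × ℝ := fun z => parab (cis (-θ) * z) with hf
  have hinj : Set.InjOn f (foldedEigs θ A) := (parab_cis_injOn θ).mono fun z hz => hz.1
  have hfin : (f '' foldedEigs θ A).Finite := by
    rw [hf, image_parab_foldedEigs, eigs_eq]
    exact (Module.End.finite_hasEigenvalue _).image _
  obtain ⟨P, hP, hfr⟩ := frontier_convexHull_finite hfin (hE.image_of_injOn hinj)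
  -- The edges of the polygon are pulled back along `f`; distinct endpoints have distinct preimages.
  refine ⟨{p | p ∈ (foldedEigs θ A).offDiag ∧ (f p.1, f p.2) ∈ P}, fun p h => h.1, ?_⟩
  ext z
  rw [mem_frontier_thetaSRGUpper, quadRange_eq_convexHull_foldedEigs θ hA, hfr]
  simp only [Set.mem_iUnion₂]
  constructor
  · rintro ⟨hz, ⟨p, q⟩, hpq, hzs⟩
    obtain ⟨⟨z₁, h₁, rfl⟩, ⟨z₂, h₂, rfl⟩, hne⟩ := hP hpq
    refine ⟨(z₁, z₂), ⟨⟨h₁, h₂, fun h => hne ?_⟩, hpq⟩, (mem_thetaArc_iff h₁.1 h₂.1).2 ⟨hz, hzs⟩⟩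
    simp only at h
    simp only [h]
  · rintro ⟨⟨z₁, z₂⟩, ⟨⟨h₁, h₂, -⟩, hpq⟩, hz⟩
    rw [mem_thetaArc_iff h₁.1 h₂.1] at hz
    exact ⟨hz.1, _, hpq, hz.2⟩

theorem frontier_thetaSRGUpper_of_subsingleton {θ : ℝ} {A : Matrix (Fin n) (Fin n) ℂ}
    (hA : IsStarNormal A) (hE : (foldedEigs θ A).Subsingleton) :
    frontier (thetaSRGUpper θ A) = foldedEigs θ A := by
  have h : thetaSRGUpper θ A = foldedEigs θ A := by
    ext z
    rw [mem_thetaSRGUpper_iff, quadRange_eq_convexHull_foldedEigs θ hA,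
      (hE.image _).convex.convexHull_eq]
    constructor
    · rintro ⟨hz, w, hw, h⟩
      rwa [← parab_cis_injOn θ hw.1 hz h]
    · exact fun hz => ⟨hz.1, z, hz, rfl⟩
  rw [h]
  rcases hE.eq_empty_or_singleton with h | ⟨z, h⟩
  · rw [h, frontier_empty]
  · rw [h, isClosed_singleton.frontier_eq, interior_singleton, Set.sdiff_empty]

end Main

end ThetaSRG

theorem mainTheorem8 (n : ℕ) (hn : 0 < n) (A : Matrix (Fin n) (Fin n) ℂ) (θ : ℝ) :
    -- 1) periodicity in the angle
    thetaSRG θ A = thetaSRG (θ + Real.pi) A ∧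
    -- 2) transpose, adjoint, rotation, scaling, unitary similarity
    (thetaSRG θ A = thetaSRG θ Aᵀ ∧
      thetaSRG θ A = (fun z : ℂ => conj z) '' thetaSRG (-θ) Aᴴ ∧
      (∀ α : ℝ, thetaSRG θ (cis α • A) = cis α • thetaSRG (θ - α) A) ∧
      (∀ γ : ℝ, 0 ≤ γ → thetaSRG θ ((γ : ℂ) • A) = (γ : ℂ) • thetaSRG θ A) ∧
      (∀ U : Matrix (Fin n) (Fin n) ℂ, U ∈ Matrix.unitaryGroup (Fin n) ℂ →
        thetaSRG θ (Uᴴ * A * U) = thetaSRG θ A)) ∧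
    -- 3) relation to the spectrum
    (thetaSRGUpper θ A ∩ thetaAxis θ = eigs A ∩ thetaAxis θ ∧
      {p | p ∈ dwShell A ∧ thetaProj θ p = p} =
        (fun l : ℂ => (l, ‖l‖ ^ 2)) '' (eigs A ∩ upperHalf θ) ∧
      {p | p ∈ dwShell A ∧ thetaProj (θ + Real.pi) p = p} =
        (fun l : ℂ => (l, ‖l‖ ^ 2)) '' (eigs A ∩ lowerHalf θ) ∧
      eigs A ⊆ thetaSRG θ A ∧
      eigs A = ⋂ φ ∈ Set.Ico (-(Real.pi / 2)) (Real.pi / 2), thetaSRG φ A) ∧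
    -- 4) simple connectedness and the arc property
    (IsSimplyConnected (thetaSRGUpper θ A) ∧
      ∀ z₁ ∈ thetaSRGUpper θ A, ∀ z₂ ∈ thetaSRGUpper θ A, z₁ ≠ z₂ →
        thetaArc θ z₁ z₂ ⊆ thetaSRGUpper θ A) ∧
    -- 5) the boundary for a normal matrix
    (IsStarNormal A →
      ((foldedEigs θ A).Nontrivial →
        ∃ P : Set (ℂ × ℂ), P ⊆ (foldedEigs θ A).offDiag ∧
          frontier (thetaSRGUpper θ A) = ⋃ p ∈ P, thetaArc θ p.1 p.2) ∧
      ((foldedEigs θ A).Subsingleton →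
        frontier (thetaSRGUpper θ A) = foldedEigs θ A)) := by
  refine ⟨thetaSRG_add_pi θ A,
    ⟨thetaSRG_transpose θ A, thetaSRG_conjTranspose θ A, fun α => thetaSRG_cis_smul θ α A,
      fun γ _ => thetaSRG_real_smul hn θ γ A, fun U hU => thetaSRG_unitary θ A hU⟩,
    ⟨thetaSRGUpper_inter_thetaAxis θ A, dwShell_fixed θ A, ?_, eigs_subset_thetaSRG θ A,
      eigs_eq_iInter_thetaSRG A⟩,
    ⟨isSimplyConnected_thetaSRGUpper hn θ A,
      fun z₁ h₁ z₂ h₂ _ => thetaArc_subset_thetaSRGUpper h₁ h₂⟩,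
    fun hA => ⟨frontier_thetaSRGUpper_of_nontrivial hA,
      frontier_thetaSRGUpper_of_subsingleton hA⟩⟩
  rw [dwShell_fixed, upperHalf_add_pi]
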